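/- Let $A:\mathbb R_{\ge 0}\to\mathbb R^{n\times n}$ and $C:\mathbb R_{\ge 0}\to\mathbb R^{p\times n}$ be continuous and bounded and consider the linear time-varying system $\dot x=A(t)x$, $y=C(t)x$. For a matrix $Q$ with columns $q_1,\dots,q_k$ and $A\in\mathbb R^{n\times n}$ let $S(A,Q)$ be the skew-symmetric $k\times k$ matrix with entries $s_{ij}=q_i^{\top}Aq_j$ for $i>j$. Let $t_0\ge 0$, let $X$ be a fundamental solution of $\dot X=A(t)X$ on $\mathbb R_{\ge0}$ ($X(0)$ nonsingular), and let $X=QR$ be its continuous QR decomposition: $X(t_0)=Q(t_0)R(t_0)$ with $Q(t_0)$ orthogonal and $R(t_0)$ upper triangular, and on $\mathbb R_{\ge 0}$ $$\dot Q=Q\,S(t),\qquad \dot R=\bigl(Q^{\top}A(t)Q-S(t)\bigr)R,\qquad S(t)=S(A(t),Q(t)).$$ The upper Bohl exponent of $b:\mathbb R_{\ge0}\to\mathbb R$ is $\beta^{\mathrm s}(b)=\limsup_{s\to\infty,\,H\to\infty}\frac1H\int_s^{s+H}b(\tau)\,d\tau$. Let $j^\star$ be the first integer $0\le j^\star\le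 n$ such that $\beta^{\mathrm s}(q_i^{\top}Aq_i)<0$ for all $i=j^\star+1,\dots,n$, where $q_i(t)$ is the $i$-th column of $Q(t)$. Let $\bar Q(t)\in\mathbb R^{n\times j^\star}$ consist of the first $j^\star$ columns of $Q(t)$ and put $B_1(t)=\bar Q^{\top}(t)A(t)\bar Q(t)-S(A(t),\bar Q(t))$. Assume that the pair $(B_1(t),\,C(t)\bar Q(t))$ is uniformly completely observable: there are $\alpha_1,\alpha_2,T>0$ with $$\alpha_1I\preceq\int_{s}^{s+T}\Phi(\tau,s+T)^{\top}\bar Q(\tau)^{\top}C(\tau)^{\top}C(\tau)\bar Q(\tau)\Phi(\tau,s+T)\,d\tau\preceq\alpha_2I\qquad\text{for all }s\ge0,$$ where $\Phi$ is the state transition matrix of $\dot z=B_1(t)z$. Then: 1. For every continuous $G_1:[t_0,\infty)\to\mathbb R^{j^\star\times j^\star}$ with symmetric values and $g_1I\preceq G_1(t)\preceq g_2I$ for some constants $g_1,g_2>0$, and for every symmetric positive definite $P_0\in\mathbb R^{j^\star\times j^\star}$, the Riccati equation $$\dot P_1=B_1(t)P_1+P_1B_1^{\top}(t)-P_1\bar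 Q^{\top}(t)C^{\top}(t)C(t)\bar Q(t)P_1+G_1(t),\qquad P_1(t_0)=P_0,$$ has a solution $P_1$ on $[t_0,\infty)$ that is bounded and positive definite, namely $p_1I\preceq P_1(t)\preceq p_2I$ for all $t\ge t_0$ with constants $p_1,p_2>0$. With the gain $L(t)=\bar Q(t)P_1(t)\bar Q^{\top}(t)C^{\top}(t)$ the error system $\dot e=[A(t)-L(t)C(t)]e$ is uniformly exponentially stable on $[t_0,\infty)$: there are $K\ge1$, $\mu>0$ such that $\|e(t)\|\le Ke^{-\mu(t-s)}\|e(s)\|$ for all $t\ge s\ge t_0$ and every solution $e$ on $[s,\infty)$. 2. The system is uniformly exponentially detectable: there is a continuous bounded $L:\mathbb R_{\ge0}\to\mathbb R^{n\times p}$ such that $\dot e=[A(t)-L(t)C(t)]e$ is uniformly exponentially stable on $[0,\infty)$. -/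

import Mathlib

open scoped Matrix Matrix.Norms.L2Operator

noncomputable section

/-! Time runs over `[0, ∞)`; functions of time are functions on `ℝ` of which only the values on
`[0, ∞)` matter, and derivatives at the left end point are one-sided. The norm `‖·‖` of a matrix is
the operator norm induced by the Euclidean norm. -/

/-- `X` is a fundamental solution of `ẋ = A(t) x` on `[0, ∞)`: `Ẋ = A(t) X`, `X(0)` nonsingular. -/
structure IsFundamentalSolution {n : ℕ} (A X : ℝ → Matrix (Fin n) (Fin n) ℝ) : Prop where
  ode : ∀ t, 0 ≤ t → HasDerivWithinAt X (A t * X t) (Set.Ici 0) t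
  nonsingular : IsUnit (X 0)

/-- The skew-symmetric `k × k` matrix `S` with `s_ij = q_iᵀ A q_j` for `i > j`, where `q_i` are the
columns of the `n × k` matrix `Q`. -/
def skewMatrix {n k : ℕ} (A : Matrix (Fin n) (Fin n) ℝ) (Q : Matrix (Fin n) (Fin k) ℝ) :
    Matrix (Fin k) (Fin k) ℝ :=
  Matrix.of fun i j =>
    if j < i then (Qᵀ * A * Q) i j else if i < j then -(Qᵀ * A * Q) j i else 0

/-- The coefficient matrix `B = Qᵀ A Q - S` of the transformed system. -/
def transformedMatrix {n k : ℕ} (A : Matrix (Fin n) (Fin n) ℝ) (Q : Matrix (Fin n) (Fin k) ℝ) :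
    Matrix (Fin k) (Fin k) ℝ :=
  Qᵀ * A * Q - skewMatrix A Q

/-- `X = Q R` is the continuous QR decomposition of the fundamental solution `X` of `ẋ = A(t) x`
with initial factorization at time `t₀`: `X(t₀) = Q(t₀) R(t₀)` with `Q(t₀)` orthogonal and `R(t₀)`
upper triangular, and `Q̇ = Q S(t)`, `Ṙ = B(t) R` on `[0, ∞)`. -/
structure IsContinuousQR {n : ℕ} (A : ℝ → Matrix (Fin n) (Fin n) ℝ) (t₀ : ℝ)
    (X Q R : ℝ → Matrix (Fin n) (Fin n) ℝ) : Prop where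
  fundamental : IsFundamentalSolution A X
  init : X t₀ = Q t₀ * R t₀
  orthogonal_init : (Q t₀)ᵀ * Q t₀ = 1
  upper_init : ∀ i j : Fin n, j < i → R t₀ i j = 0
  ode_Q : ∀ t, 0 ≤ t → HasDerivWithinAt Q (Q t * skewMatrix (A t) (Q t)) (Set.Ici 0) t
  ode_R : ∀ t, 0 ≤ t → HasDerivWithinAt R (transformedMatrix (A t) (Q t) * R t) (Set.Ici 0) t

/-- The upper Bohl exponent of `b`: the limit superior, as `s → ∞` and `H → ∞` (jointly and
independently), of the averages of `b` over `[s, s + H]`. -/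
def upperBohlExponent (b : ℝ → ℝ) : EReal :=
  Filter.limsup (fun p : ℝ × ℝ => (((p.2)⁻¹ * ∫ τ in p.1..(p.1 + p.2), b τ : ℝ) : EReal))
    (Filter.atTop ×ˢ Filter.atTop)

/-- The set of all `0 ≤ j ≤ n` such that the diagonal terms `q_iᵀ A q_i` have negative upper Bohl
exponents for `i = j + 1, …, n` (columns counted from 1; `Fin n` counts them from 0). -/
def stableTailIndices {n : ℕ} (A Q : ℝ → Matrix (Fin n) (Fin n) ℝ) : Set ℕ :=
  {j | j ≤ n ∧ ∀ i : Fin n, j ≤ (i : ℕ) →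
    upperBohlExponent (fun t => ((Q t)ᵀ * A t * Q t) i i) < 0}

/-- The first `k` columns of `Q`. -/
def leadingColumns {n k : ℕ} (h : k ≤ n) (Q : Matrix (Fin n) (Fin n) ℝ) :
    Matrix (Fin n) (Fin k) ℝ :=
  Q.submatrix id (Fin.castLE h)

/-- The constructibility Gramian `∫_{s}^{t} Φ(τ,t)ᵀ C(τ)ᵀ C(τ) Φ(τ,t) dτ`, where
`Φ(τ,t) = X(τ) X(t)⁻¹` is the state transition matrix obtained from a fundamental solution `X`. -/
def constructibilityGramian {k p : ℕ} (X : ℝ → Matrix (Fin k) (Fin k) ℝ)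
    (C : ℝ → Matrix (Fin p) (Fin k) ℝ) (t s : ℝ) : Matrix (Fin k) (Fin k) ℝ :=
  ∫ τ in s..t, (X τ * (X t)⁻¹)ᵀ * (C τ)ᵀ * C τ * (X τ * (X t)⁻¹)

/-- Uniform complete observability of the pair `(A, C)`. The state transition matrix, hence the
Gramian, does not depend on the fundamental solution `X`. -/
def IsUniformlyCompletelyObservable {k p : ℕ} (A : ℝ → Matrix (Fin k) (Fin k) ℝ)
    (C : ℝ → Matrix (Fin p) (Fin k) ℝ) : Prop :=
  ∃ X : ℝ → Matrix (Fin k) (Fin k) ℝ, IsFundamentalSolution A X ∧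
    ∃ α₁ α₂ T : ℝ, 0 < α₁ ∧ 0 < α₂ ∧ 0 < T ∧ ∀ s, 0 ≤ s →
      (constructibilityGramian X C (s + T) s - α₁ • (1 : Matrix (Fin k) (Fin k) ℝ)).PosSemidef ∧
      (α₂ • (1 : Matrix (Fin k) (Fin k) ℝ) - constructibilityGramian X C (s + T) s).PosSemidef

/-- `x` solves `ẋ = A(t) x` on `[s, ∞)`. -/
def IsSolutionFrom {n : ℕ} (A : ℝ → Matrix (Fin n) (Fin n) ℝ) (s : ℝ)
    (x : ℝ → EuclideanSpace ℝ (Fin n)) : Prop :=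
  ∀ t, s ≤ t → HasDerivWithinAt x (WithLp.toLp 2 (A t *ᵥ (x t).ofLp)) (Set.Ici s) t

/-- (Global) uniform exponential stability of `ẋ = A(t) x` on the time axis `[t₀, ∞)`. -/
def IsUniformlyExponentiallyStable {n : ℕ} (t₀ : ℝ) (A : ℝ → Matrix (Fin n) (Fin n) ℝ) : Prop :=
  ∃ μ K : ℝ, 0 < μ ∧ 1 ≤ K ∧ ∀ s, t₀ ≤ s → ∀ x : ℝ → EuclideanSpace ℝ (Fin n),
    IsSolutionFrom A s x → ∀ t, s ≤ t → ‖x t‖ ≤ K * Real.exp (-μ * (t - s)) * ‖x s‖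

/-- Uniform exponential detectability of `ẋ = A(t) x`, `y = C(t) x`: some continuous bounded gain
`L` on `[0, ∞)` makes `ė = (A(t) - L(t) C(t)) e` uniformly exponentially stable. -/
def IsUniformlyExponentiallyDetectable {n p : ℕ} (A : ℝ → Matrix (Fin n) (Fin n) ℝ)
    (C : ℝ → Matrix (Fin p) (Fin n) ℝ) : Prop :=
  ∃ L : ℝ → Matrix (Fin n) (Fin p) ℝ, ContinuousOn L (Set.Ici 0) ∧
    (∃ M : ℝ, ∀ t, 0 ≤ t → ‖L t‖ ≤ M) ∧
    IsUniformlyExponentiallyStable 0 (fun t => A t - L t * C t)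

/-- `P` solves the observer Riccati equation `Ṗ = B P + P Bᵀ - P Dᵀ D P + G` on `[t₀, ∞)`. -/
def IsRiccatiSolution {k p : ℕ} (t₀ : ℝ) (B : ℝ → Matrix (Fin k) (Fin k) ℝ)
    (D : ℝ → Matrix (Fin p) (Fin k) ℝ) (G P : ℝ → Matrix (Fin k) (Fin k) ℝ) : Prop :=
  ∀ t, t₀ ≤ t → HasDerivWithinAt P
    (B t * P t + P t * (B t)ᵀ - P t * (D t)ᵀ * D t * P t + G t) (Set.Ici t₀) t

/-- `a I ≼ M(t) ≼ b I` for all `t ≥ t₀`; in particular every such `M(t)` is symmetric. -/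
def LoewnerBounds {k : ℕ} (t₀ a b : ℝ) (M : ℝ → Matrix (Fin k) (Fin k) ℝ) : Prop :=
  ∀ t, t₀ ≤ t → (M t - a • (1 : Matrix (Fin k) (Fin k) ℝ)).PosSemidef ∧
    (b • (1 : Matrix (Fin k) (Fin k) ℝ) - M t).PosSemidef

end

/-!
In the moving frame `z = Qᵀ x` the system has the upper triangular bounded coefficient matrix
`B = Qᵀ A Q - S`, and `B₁` is its leading `j × j` block. The gain `Q̄ P₁ Q̄ᵀ Cᵀ` only acts on the
leading coordinates, so the trailing ones keep their triangular dynamics: they solve scalar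
equations, each driven by the later coordinates, whose diagonal coefficients have negative upper
Bohl exponents, and hence decay uniformly by backward recursion. The leading coordinates satisfy
the error equation of a Kalman-Bucy observer with a perturbation coming from the trailing ones.

For the Kalman-Bucy observer, `V = zᵀ P₁⁻¹ z` decays exponentially along solutions, up to an
exponentially small forcing, once `p₁ I ≼ P₁ ≼ p₂ I`. The lower bound on `P₁` follows from
`G₁ ≽ g₁ I` by comparison with a constant subsolution. For the upper bound, completing the square
shows that `lᵀ P₁ l` is at most the cost of steering the dual system `l̇ = -B₁ᵀ l + Q̄ᵀ Cᵀ u` from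
`0` to `l`; observability over a window of length `T` provides a control of uniformly bounded cost.
-/

open Set Matrix

/-! ### Comparison on half-lines -/

theorem le_of_hasDerivWithinAt_le {a b : ℝ} {f g f' g' : ℝ → ℝ}
    (hf : ∀ t, a ≤ t → HasDerivWithinAt f (f' t) (Ici a) t)
    (hg : ∀ t, a ≤ t → HasDerivWithinAt g (g' t) (Ici a) t)
    (h₀ : f a ≤ g a) (hab : a ≤ b) (h : ∀ t, a ≤ t → t ≤ b → f' t ≤ g' t) : f b ≤ g b :=
  image_le_of_deriv_right_le_deriv_boundary
    (fun t ht => (hf t ht.1).continuousWithinAt.mono Icc_subset_Ici_self)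
    (fun t ht => (hf t ht.1).mono (Ici_subset_Ici.2 ht.1)) h₀
    (fun t ht => (hg t ht.1).continuousWithinAt.mono Icc_subset_Ici_self)
    (fun t ht => (hg t ht.1).mono (Ici_subset_Ici.2 ht.1))
    (fun t ht => h t ht.1 ht.2.le) (right_mem_Icc.2 hab)

theorem eq_of_hasDerivWithinAt_zero {E : Type*} [NormedAddCommGroup E] [NormedSpace ℝ E] {a b : ℝ}
    {f : ℝ → E} (hf : ∀ t, a ≤ t → HasDerivWithinAt f 0 (Ici a) t) (hab : a ≤ b) : f b = f a :=
  constant_of_has_deriv_right_zero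
    (fun t ht => (hf t ht.1).continuousWithinAt.mono Icc_subset_Ici_self)
    (fun t ht => (hf t ht.1).mono (Ici_subset_Ici.2 ht.1)) b (right_mem_Icc.2 hab)

theorem hasDerivWithinAt_integral_Ici {E : Type*} [NormedAddCommGroup E] [NormedSpace ℝ E]
    [CompleteSpace E] {f : ℝ → E} {a : ℝ} (hf : ContinuousOn f (Ici a)) {t : ℝ} (ht : a ≤ t) :
    HasDerivWithinAt (fun t => ∫ τ in a..t, f τ) (f t) (Ici a) t := by
  let g : ℝ → E := fun t => f (max a t)
  have hg : Continuous g := hf.comp_continuous (by fun_prop) fun t => le_max_left a t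
  have heq : ∀ τ, a ≤ τ → f τ = g τ := fun τ hτ => by simp only [g, max_eq_right hτ]
  have hint : ∀ τ, a ≤ τ → ∫ σ in a..τ, f σ = ∫ σ in a..τ, g σ := fun τ hτ =>
    intervalIntegral.integral_congr fun σ hσ => by
      rw [uIcc_of_le hτ] at hσ
      exact heq σ hσ.1
  rw [heq t ht]
  exact (hg.integral_hasStrictDerivAt a t).hasDerivAt.hasDerivWithinAt.congr hint (hint t ht)

/-! ### Global solutions of linear differential equations -/

section LinearODE

variable {E : Type*} [NormedAddCommGroup E] [NormedSpace ℝ E]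

/-- The radial retraction onto the closed ball of radius `r`. It truncates the right-hand side of a
linear differential equation, which becomes bounded. -/
noncomputable def radialRetraction (r : ℝ) (x : E) : E :=
  (r / max r ‖x‖) • x

theorem norm_radialRetraction {r : ℝ} (hr : 0 < r) (x : E) :
    ‖radialRetraction r x‖ = r / max r ‖x‖ * ‖x‖ := by
  rw [radialRetraction, norm_smul, Real.norm_of_nonneg (by positivity)]

theorem norm_radialRetraction_le {r : ℝ} (hr : 0 < r) (x : E) : ‖radialRetraction r x‖ ≤ r := by
  rw [norm_radialRetraction hr, div_mul_eq_mul_div, div_le_iff₀ (lt_max_of_lt_left hr)]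
  gcongr
  exact le_max_right _ _

theorem norm_radialRetraction_le_norm {r : ℝ} (hr : 0 < r) (x : E) :
    ‖radialRetraction r x‖ ≤ ‖x‖ := by
  rw [norm_radialRetraction hr]
  exact mul_le_of_le_one_left (norm_nonneg _)
    ((div_le_one (lt_max_of_lt_left hr)).2 (le_max_left _ _))

theorem radialRetraction_of_norm_le {r : ℝ} (hr : 0 < r) {x : E} (hx : ‖x‖ ≤ r) :
    radialRetraction r x = x := by
  rw [radialRetraction, max_eq_left hx, div_self hr.ne', one_smul]

theorem lipschitzWith_radialRetraction {r : ℝ} (hr : 0 < r) :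
    LipschitzWith 2 (radialRetraction r : E → E) := by
  refine LipschitzWith.of_dist_le_mul fun x y => ?_
  rw [dist_eq_norm, dist_eq_norm, NNReal.coe_ofNat]
  have hx : 0 < max r ‖x‖ := lt_max_of_lt_left hr
  have hy : 0 < max r ‖y‖ := lt_max_of_lt_left hr
  have hcoef : r / max r ‖x‖ ≤ 1 := (div_le_one hx).2 (le_max_left _ _)
  have hmax : |max r ‖y‖ - max r ‖x‖| ≤ ‖x - y‖ := by
    rw [max_comm r, max_comm r, norm_sub_rev]
    exact (abs_max_sub_max_le_abs _ _ _).trans (abs_norm_sub_norm_le y x)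
  have hsplit : radialRetraction r x - radialRetraction r y = (r / max r ‖x‖) • (x - y) +
      (r / max r ‖x‖ * (max r ‖y‖ - max r ‖x‖) / max r ‖y‖) • y := by
    have : r / max r ‖x‖ * (max r ‖y‖ - max r ‖x‖) / max r ‖y‖ =
        r / max r ‖x‖ - r / max r ‖y‖ := by field_simp
    rw [this, radialRetraction, radialRetraction, smul_sub, sub_smul]
    abel
  calc ‖radialRetraction r x - radialRetraction r y‖
      ≤ r / max r ‖x‖ * ‖x - y‖ +
        r / max r ‖x‖ * |max r ‖y‖ - max r ‖x‖| * (‖y‖ / max r ‖y‖) := by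
        rw [hsplit]
        refine (norm_add_le _ _).trans_eq ?_
        rw [norm_smul, norm_smul, norm_div _ (max r ‖y‖), norm_mul,
          Real.norm_of_nonneg (div_nonneg hr.le hx.le), Real.norm_eq_abs, Real.norm_of_nonneg hy.le]
        ring
    _ ≤ 1 * ‖x - y‖ + 1 * ‖x - y‖ * 1 := by
        gcongr
        exact (div_le_one hy).2 (le_max_right _ _)
    _ = 2 * ‖x - y‖ := by ring

theorem isPicardLindelof_comp_radialRetraction {a b M r : ℝ} (hab : a ≤ b) {F : ℝ → E →L[ℝ] E}
    (hF : ContinuousOn F (Icc a b)) (hM : ∀ t ∈ Icc a b, ‖F t‖ ≤ M) (hr : 0 < r) (x₀ : E) :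
    IsPicardLindelof (fun t x => F t (radialRetraction r x)) (⟨a, left_mem_Icc.2 hab⟩ : Icc a b) x₀
      (M * r * (b - a)).toNNReal 0 (M * r).toNNReal (M * 2).toNNReal := by
  have hM0 : 0 ≤ M := (norm_nonneg _).trans (hM a (left_mem_Icc.2 hab))
  have hba : 0 ≤ b - a := sub_nonneg.2 hab
  refine ⟨fun t ht => LipschitzWith.lipschitzOnWith ?_, fun x _ => hF.clm_apply continuousOn_const,
    fun t ht x _ => ?_, ?_⟩
  · refine ((F t).lipschitz.comp (lipschitzWith_radialRetraction hr)).weaken ?_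
    rw [← NNReal.coe_le_coe, Real.coe_toNNReal _ (by positivity)]
    push_cast
    gcongr
    exact hM t ht
  · rw [Real.coe_toNNReal _ (by positivity)]
    exact (F t).le_of_opNorm_le_of_le (hM t ht) (norm_radialRetraction_le hr x)
  · rw [Real.coe_toNNReal _ (by positivity), Real.coe_toNNReal _ (by positivity)]
    simp [hba]

theorem exists_linearODE_Icc [CompleteSpace E] {a b : ℝ} (hab : a ≤ b) {F : ℝ → E →L[ℝ] E}
    (hF : ContinuousOn F (Icc a b)) (x₀ : E) :
    ∃ x : ℝ → E, x a = x₀ ∧ ∀ t ∈ Icc a b, HasDerivWithinAt x (F t (x t)) (Icc a b) t := by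
  obtain ⟨M, hM⟩ := isCompact_Icc.exists_bound_of_continuousOn hF
  have hM0 : 0 ≤ M := (norm_nonneg _).trans (hM a (left_mem_Icc.2 hab))
  set r : ℝ := ‖x₀‖ * Real.exp (M * (b - a)) + 1 with hr
  have hr0 : 0 < r := by positivity
  obtain ⟨x, hxa, hx⟩ := (isPicardLindelof_comp_radialRetraction hab hF hM hr0
    x₀).exists_eq_forall_mem_Icc_hasDerivWithinAt₀
  refine ⟨x, hxa, fun t ht => ?_⟩
  have hgronwall : ‖x t‖ ≤ gronwallBound ‖x₀‖ M 0 (t - a) :=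
    norm_le_gronwallBound_of_norm_deriv_right_le (fun t ht => (hx t ht).continuousWithinAt)
      (fun t ht => (hx t ⟨ht.1, ht.2.le⟩).mono_of_mem_nhdsWithin (Icc_mem_nhdsGE_of_mem ht))
      (congrArg norm hxa).le
      (fun t ht => (add_zero (M * ‖x t‖)).symm ▸ (F t).le_of_opNorm_le_of_le
        (hM t ⟨ht.1, ht.2.le⟩) (norm_radialRetraction_le_norm hr0 _)) t ht
  have hxr : ‖x t‖ ≤ r := by
    rw [gronwallBound_ε0] at hgronwall
    calc ‖x t‖ ≤ ‖x₀‖ * Real.exp (M * (b - a)) := hgronwall.trans (by gcongr; exact ht.2)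
      _ ≤ r := by rw [hr]; linarith
  simpa only [radialRetraction_of_norm_le hr0 hxr] using hx t ht

theorem eqOn_of_linearODE_Icc {a b : ℝ} {F : ℝ → E →L[ℝ] E} (hF : ContinuousOn F (Icc a b))
    {x y : ℝ → E} (hx : ∀ t ∈ Icc a b, HasDerivWithinAt x (F t (x t)) (Icc a b) t)
    (hy : ∀ t ∈ Icc a b, HasDerivWithinAt y (F t (y t)) (Icc a b) t) (hxy : x a = y a) :
    EqOn x y (Icc a b) := by
  obtain ⟨M, hM⟩ := isCompact_Icc.exists_bound_of_continuousOn hF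
  refine ODE_solution_unique_of_mem_Icc_right (v := fun t x => F t x) (s := fun _ => univ)
    (K := M.toNNReal)
    (fun t ht => LipschitzWith.lipschitzOnWith ((F t).lipschitz.weaken ?_))
    (fun t ht => (hx t ht).continuousWithinAt)
    (fun t ht => (hx t ⟨ht.1, ht.2.le⟩).mono_of_mem_nhdsWithin (Icc_mem_nhdsGE_of_mem ht))
    (fun _ _ => mem_univ _)
    (fun t ht => (hy t ht).continuousWithinAt)
    (fun t ht => (hy t ⟨ht.1, ht.2.le⟩).mono_of_mem_nhdsWithin (Icc_mem_nhdsGE_of_mem ht))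
    (fun _ _ => mem_univ _) hxy
  rw [← norm_toNNReal]
  exact Real.toNNReal_le_toNNReal (hM t ⟨ht.1, ht.2.le⟩)

theorem exists_linearODE_Ici [CompleteSpace E] {a : ℝ} {F : ℝ → E →L[ℝ] E}
    (hF : ContinuousOn F (Ici a)) (x₀ : E) :
    ∃ x : ℝ → E, x a = x₀ ∧ ∀ t, a ≤ t → HasDerivWithinAt x (F t (x t)) (Ici a) t := by
  choose y hya hy using fun N : ℕ => exists_linearODE_Icc (b := a + N) (by simp)
    (hF.mono Icc_subset_Ici_self) x₀
  have hunique {N N' : ℕ} (hN : N ≤ N') : EqOn (y N) (y N') (Icc a (a + N)) := by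
    have hle : a + (N : ℝ) ≤ a + N' := by gcongr
    refine eqOn_of_linearODE_Icc (hF.mono Icc_subset_Ici_self) (hy N) (fun t ht => ?_)
      ((hya N).trans (hya N').symm)
    exact (hy N' t ⟨ht.1, ht.2.trans hle⟩).mono (Icc_subset_Icc_right hle)
  let k : ℝ → ℕ := fun t => ⌈t - a⌉₊
  have hk t : t ≤ a + k t := by linarith [Nat.le_ceil (t - a)]
  refine ⟨fun t => y (k t) t, hya _, fun t ht => ?_⟩
  have ht_lt : t < a + ((k t + 1 : ℕ) : ℝ) := by push_cast; linarith [hk t]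
  have hglue : ∀ τ ∈ Ici a ∩ Iic (a + ((k t + 1 : ℕ) : ℝ)), y (k τ) τ = y (k t + 1) τ :=
    fun τ hτ => hunique (Nat.ceil_le.2 (by linarith [mem_Iic.1 hτ.2])) ⟨hτ.1, hk τ⟩
  have hnhds : Ici a ∩ Iic (a + ((k t + 1 : ℕ) : ℝ)) ∈ nhdsWithin t (Ici a) :=
    inter_mem_nhdsWithin _ (Iic_mem_nhds ht_lt)
  have hderiv := (hy (k t + 1) t ⟨ht, ht_lt.le⟩).mono_of_mem_nhdsWithin (s := Ici a)
    (by rwa [← Ici_inter_Iic])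
  have heq_t := hglue t ⟨ht, ht_lt.le⟩
  rw [← heq_t] at hderiv
  exact hderiv.congr_of_eventuallyEq (Filter.eventually_of_mem hnhds hglue) heq_t

end LinearODE

/-! ### Matrices as bounded bilinear maps -/

section MatrixCalculus

variable {l m n : Type*} [Fintype l] [Fintype m] [Fintype n] [DecidableEq n]

/-- Matrix-vector multiplication on Euclidean spaces as a bounded bilinear map. -/
noncomputable def mulVecL :
    Matrix m n ℝ →L[ℝ] EuclideanSpace ℝ n →L[ℝ] EuclideanSpace ℝ m :=
  LinearMap.mkContinuous₂ (toEuclideanLin (𝕜 := ℝ) (m := m) (n := n)).toLinearMap 1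
    fun M x => (l2_opNorm_mulVec M x).trans_eq (by rw [one_mul])

theorem mulVecL_apply (M : Matrix m n ℝ) (x : EuclideanSpace ℝ n) (i : m) :
    mulVecL M x i = ∑ k, M i k * x k := rfl

theorem norm_mulVecL_le (M : Matrix m n ℝ) (x : EuclideanSpace ℝ n) :
    ‖mulVecL M x‖ ≤ ‖M‖ * ‖x‖ :=
  l2_opNorm_mulVec M x

theorem l2_opNorm_le_of_norm_mulVecL_le {M : Matrix m n ℝ} {c : ℝ} (hc : 0 ≤ c)
    (h : ∀ x, ‖mulVecL M x‖ ≤ c * ‖x‖) : ‖M‖ ≤ c := by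
  rw [l2_opNorm_def]
  exact ContinuousLinearMap.opNorm_le_bound _ hc h

theorem mulVecL_mul [DecidableEq m] (M : Matrix l m ℝ) (N : Matrix m n ℝ) (x : EuclideanSpace ℝ n) :
    mulVecL (M * N) x = mulVecL M (mulVecL N x) :=
  congrArg (WithLp.toLp 2) (mulVec_mulVec x.ofLp M N).symm

@[simp] theorem mulVecL_one (x : EuclideanSpace ℝ n) : mulVecL (1 : Matrix n n ℝ) x = x :=
  congrArg (WithLp.toLp 2) (one_mulVec x.ofLp)

theorem mulVecL_mulVecL_inv {M : Matrix n n ℝ} (h : IsUnit M) (x : EuclideanSpace ℝ n) :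
    mulVecL M (mulVecL M⁻¹ x) = x := by
  rw [← mulVecL_mul, mul_nonsing_inv _ ((isUnit_iff_isUnit_det _).1 h), mulVecL_one]

theorem mulVecL_inv_mulVecL {M : Matrix n n ℝ} (h : IsUnit M) (x : EuclideanSpace ℝ n) :
    mulVecL M⁻¹ (mulVecL M x) = x := by
  rw [← mulVecL_mul, nonsing_inv_mul _ ((isUnit_iff_isUnit_det _).1 h), mulVecL_one]

theorem inner_mulVecL_left [DecidableEq m] (M : Matrix m n ℝ) (x : EuclideanSpace ℝ n)
    (y : EuclideanSpace ℝ m) :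
    inner ℝ (mulVecL M x) y = inner ℝ x (mulVecL Mᵀ y) := by
  change y.ofLp ⬝ᵥ M *ᵥ x.ofLp = Mᵀ *ᵥ y.ofLp ⬝ᵥ x.ofLp
  rw [mulVec_transpose, dotProduct_mulVec]

theorem inner_mulVecL_right [DecidableEq m] (M : Matrix m n ℝ) (x : EuclideanSpace ℝ n)
    (y : EuclideanSpace ℝ m) :
    inner ℝ y (mulVecL M x) = inner ℝ (mulVecL Mᵀ y) x := by
  rw [inner_mulVecL_left, transpose_transpose]

theorem inner_mulVecL_transpose_self (M : Matrix n n ℝ) (x : EuclideanSpace ℝ n) :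
    inner ℝ x (mulVecL Mᵀ x) = inner ℝ x (mulVecL M x) := by
  rw [← inner_mulVecL_left, real_inner_comm]

theorem inner_mulVecL_transpose_mul_self (M : Matrix m n ℝ) (x : EuclideanSpace ℝ n) :
    inner ℝ x (mulVecL (Mᵀ * M) x) = ‖mulVecL M x‖ ^ 2 := by
  classical
  rw [mulVecL_mul, ← inner_mulVecL_left, real_inner_self_eq_norm_sq]

theorem abs_inner_mulVecL_le (M : Matrix n n ℝ) (x : EuclideanSpace ℝ n) :
    |inner ℝ x (mulVecL M x)| ≤ ‖M‖ * ‖x‖ ^ 2 := by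
  calc |inner ℝ x (mulVecL M x)| ≤ ‖x‖ * ‖mulVecL M x‖ := abs_real_inner_le_norm _ _
    _ ≤ ‖x‖ * (‖M‖ * ‖x‖) := by gcongr; exact norm_mulVecL_le M x
    _ = ‖M‖ * ‖x‖ ^ 2 := by ring

theorem l2_opNorm_transpose [DecidableEq m] (M : Matrix m n ℝ) : ‖Mᵀ‖ = ‖M‖ := by
  rw [← conjTranspose_eq_transpose_of_trivial, l2_opNorm_conjTranspose]

/-- Matrix multiplication as a bounded bilinear map. -/
noncomputable def matrixMulL [DecidableEq m] :
    Matrix l m ℝ →L[ℝ] Matrix m n ℝ →L[ℝ] Matrix l n ℝ :=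
  LinearMap.mkContinuous₂ (LinearMap.mk₂ ℝ (· * ·) Matrix.add_mul
    (fun c M N => Matrix.smul_mul c M N) Matrix.mul_add (fun c M N => Matrix.mul_smul M c N)) 1
    fun M N => (l2_opNorm_mul M N).trans_eq (by rw [one_mul])

end MatrixCalculus

section MatrixDerivatives

variable {l m n : Type*} [Fintype m] {s : Set ℝ} {t : ℝ}

@[fun_prop]
theorem continuousOn_matrix_mul {M : ℝ → Matrix l m ℝ} {N : ℝ → Matrix m n ℝ}
    (hM : ContinuousOn M s) (hN : ContinuousOn N s) : ContinuousOn (fun t => M t * N t) s :=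
  (continuous_fst.matrix_mul continuous_snd).comp_continuousOn (hM.prodMk hN)

@[fun_prop]
theorem continuousOn_matrix_transpose {M : ℝ → Matrix l n ℝ} (hM : ContinuousOn M s) :
    ContinuousOn (fun t => (M t)ᵀ) s :=
  continuous_id.matrix_transpose.comp_continuousOn hM

theorem hasDerivWithinAt_matrix_mul [Finite l] [Finite n] {M : ℝ → Matrix l m ℝ}
    {N : ℝ → Matrix m n ℝ} {M' : Matrix l m ℝ} {N' : Matrix m n ℝ}
    (hM : HasDerivWithinAt M M' s t) (hN : HasDerivWithinAt N N' s t) :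
    HasDerivWithinAt (fun t => M t * N t) (M t * N' + M' * N t) s t := by
  classical
  cases nonempty_fintype l
  cases nonempty_fintype n
  exact (matrixMulL (l := l) (m := m) (n := n)).hasDerivWithinAt_of_bilinear hM hN

theorem hasDerivWithinAt_matrix_transpose [Finite l] [Finite n] {M : ℝ → Matrix l n ℝ}
    {M' : Matrix l n ℝ} (hM : HasDerivWithinAt M M' s t) :
    HasDerivWithinAt (fun t => (M t)ᵀ) M'ᵀ s t := by
  classical
  cases nonempty_fintype l
  cases nonempty_fintype n
  exact (transposeLinearEquiv l n ℝ ℝ).toLinearMap.toContinuousLinearMap.hasFDerivAt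
    |>.comp_hasDerivWithinAt t hM

variable [DecidableEq m]

theorem hasDerivWithinAt_matrix_inv {M : ℝ → Matrix m m ℝ} {M' : Matrix m m ℝ}
    (hM : HasDerivWithinAt M M' s t) (h_unit : IsUnit (M t)) :
    HasDerivWithinAt (fun t => (M t)⁻¹) (-((M t)⁻¹ * M' * (M t)⁻¹)) s t := by
  obtain ⟨u, hu⟩ := h_unit
  have hinv := hasFDerivAt_ringInverse (𝕜 := ℝ) u
  rw [hu] at hinv
  have hu_inv : ((↑u⁻¹ : Matrix m m ℝ)) = (M t)⁻¹ := by rw [← hu, coe_units_inv]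
  simpa [hu_inv, Function.comp_def, nonsing_inv_eq_ringInverse] using
    hinv.comp_hasDerivWithinAt t hM

theorem hasDerivWithinAt_mulVecL [Fintype l] {M : ℝ → Matrix l m ℝ} {x : ℝ → EuclideanSpace ℝ m}
    {M' : Matrix l m ℝ} {x' : EuclideanSpace ℝ m}
    (hM : HasDerivWithinAt M M' s t) (hx : HasDerivWithinAt x x' s t) :
    HasDerivWithinAt (fun t => mulVecL (M t) (x t)) (mulVecL (M t) x' + mulVecL M' (x t)) s t :=
  (mulVecL (m := l) (n := m)).hasDerivWithinAt_of_bilinear hM hx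

end MatrixDerivatives

/-! ### The Loewner order -/

section Loewner

theorem posDef_of_posSemidef_sub_smul_one {n : Type*} [DecidableEq n] {M : Matrix n n ℝ} {c : ℝ}
    (hc : 0 < c) (h : (M - c • (1 : Matrix n n ℝ)).PosSemidef) : M.PosDef := by
  simpa using (PosDef.one.smul hc).add_posSemidef h

variable {n : Type*} [Fintype n] [DecidableEq n] {M : Matrix n n ℝ} {c : ℝ}

theorem posSemidef_iff_inner :
    M.PosSemidef ↔ Mᵀ = M ∧ ∀ x : EuclideanSpace ℝ n, 0 ≤ inner ℝ x (mulVecL M x) := by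
  rw [posSemidef_iff_dotProduct_mulVec, IsHermitian, conjTranspose_eq_transpose_of_trivial]
  refine and_congr_right fun _ => ⟨fun h x => ?_, fun h x => ?_⟩
  · exact (h x.ofLp).trans_eq (dotProduct_comm _ _)
  · exact (h (WithLp.toLp 2 x)).trans_eq (dotProduct_comm _ _)

theorem posSemidef_sub_smul_one_iff :
    (M - c • (1 : Matrix n n ℝ)).PosSemidef ↔
      Mᵀ = M ∧ ∀ x : EuclideanSpace ℝ n, c * ‖x‖ ^ 2 ≤ inner ℝ x (mulVecL M x) := by
  rw [posSemidef_iff_inner]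
  simp [inner_sub_right, inner_smul_right]

theorem posSemidef_smul_one_sub_iff :
    (c • (1 : Matrix n n ℝ) - M).PosSemidef ↔
      Mᵀ = M ∧ ∀ x : EuclideanSpace ℝ n, inner ℝ x (mulVecL M x) ≤ c * ‖x‖ ^ 2 := by
  rw [posSemidef_iff_inner]
  simp [inner_sub_right, inner_smul_right]

theorem posSemidef_smul_one_sub_of_norm_le (hM : Mᵀ = M) (hc : ‖M‖ ≤ c) :
    (c • (1 : Matrix n n ℝ) - M).PosSemidef :=
  posSemidef_smul_one_sub_iff.2 ⟨hM, fun x => (le_abs_self _).trans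
    ((abs_inner_mulVecL_le M x).trans (by gcongr))⟩

theorem inv_smul_one_le_inv (hM : M.PosDef) (hc : 0 < c)
    (hMc : (c • (1 : Matrix n n ℝ) - M).PosSemidef) :
    (M⁻¹ - c⁻¹ • (1 : Matrix n n ℝ)).PosSemidef := by
  obtain ⟨hMs, hform⟩ := posSemidef_smul_one_sub_iff.1 hMc
  refine posSemidef_sub_smul_one_iff.2 ⟨by rw [transpose_nonsing_inv, hMs], fun x => ?_⟩
  set y := mulVecL M⁻¹ x
  have hMy : mulVecL M y = x := mulVecL_mulVecL_inv hM.isUnit x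
  have hyx : inner ℝ y (mulVecL M x) = ‖x‖ ^ 2 := by
    rw [inner_mulVecL_right, hMs, hMy, real_inner_self_eq_norm_sq]
  have hsq := (posSemidef_iff_inner.1 hM.posSemidef).2 (y - c⁻¹ • x)
  rw [map_sub, map_smul, hMy, inner_sub_left, inner_sub_right, inner_sub_right,
    real_inner_smul_left, real_inner_smul_left, real_inner_smul_right, real_inner_smul_right, hyx,
    real_inner_self_eq_norm_sq, real_inner_comm x y] at hsq
  have hxx : c⁻¹ * (c⁻¹ * inner ℝ x (mulVecL M x)) ≤ c⁻¹ * ‖x‖ ^ 2 := by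
    gcongr
    rw [inv_mul_le_iff₀ hc]
    exact hform x
  linarith

theorem exists_pos_smul_one_le (hM : M.PosDef) :
    ∃ c : ℝ, 0 < c ∧ (M - c • (1 : Matrix n n ℝ)).PosSemidef := by
  have hbound : ((‖M⁻¹‖ + 1) • (1 : Matrix n n ℝ) - M⁻¹).PosSemidef :=
    posSemidef_smul_one_sub_of_norm_le (posSemidef_iff_inner.1 hM.inv.posSemidef).1 (by simp)
  have h := inv_smul_one_le_inv hM.inv (by positivity) hbound
  rw [nonsing_inv_nonsing_inv _ ((isUnit_iff_isUnit_det _).1 hM.isUnit)] at h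
  exact ⟨(‖M⁻¹‖ + 1)⁻¹, by positivity, h⟩

theorem inv_le_inv_smul_one (hc : 0 < c) (hMc : (M - c • (1 : Matrix n n ℝ)).PosSemidef) :
    (c⁻¹ • (1 : Matrix n n ℝ) - M⁻¹).PosSemidef := by
  obtain ⟨hMs, hform⟩ := posSemidef_sub_smul_one_iff.1 hMc
  refine posSemidef_smul_one_sub_iff.2 ⟨by rw [transpose_nonsing_inv, hMs], fun x => ?_⟩
  set y := mulVecL M⁻¹ x
  have hMy : mulVecL M y = x :=
    mulVecL_mulVecL_inv (posDef_of_posSemidef_sub_smul_one hc hMc).isUnit x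
  have hyx : inner ℝ y x ≤ ‖y‖ * ‖x‖ := real_inner_le_norm y x
  have hy_sq : c * ‖y‖ ^ 2 ≤ ‖y‖ * ‖x‖ := by simpa only [hMy] using (hform y).trans (hMy ▸ hyx)
  have hy : ‖y‖ ≤ c⁻¹ * ‖x‖ := by
    rw [le_inv_mul_iff₀ hc]
    rcases (norm_nonneg y).eq_or_lt with h | h
    · simp [← h]
    · exact le_of_mul_le_mul_left (by linarith) h
  calc inner ℝ x y ≤ ‖x‖ * ‖y‖ := real_inner_le_norm x y
    _ ≤ ‖x‖ * (c⁻¹ * ‖x‖) := by gcongr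
    _ = c⁻¹ * ‖x‖ ^ 2 := by ring

theorem norm_le_of_posDef (hM : M.PosDef) (hc : 0 < c)
    (hMc : (c • (1 : Matrix n n ℝ) - M).PosSemidef) : ‖M‖ ≤ c := by
  refine l2_opNorm_le_of_norm_mulVecL_le hc.le fun x => ?_
  set y := mulVecL M x
  have hform : c⁻¹ * ‖y‖ ^ 2 ≤ inner ℝ y (mulVecL M⁻¹ y) :=
    (posSemidef_sub_smul_one_iff.1 (inv_smul_one_le_inv hM hc hMc)).2 y
  have hinv : mulVecL M⁻¹ y = x := mulVecL_inv_mulVecL hM.isUnit x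
  have hy_sq : c⁻¹ * ‖y‖ ^ 2 ≤ ‖y‖ * ‖x‖ := by
    rw [hinv] at hform
    exact hform.trans (real_inner_le_norm y x)
  rw [inv_mul_le_iff₀ hc] at hy_sq
  rcases (norm_nonneg y).eq_or_lt with h | h
  · rw [← h]; positivity
  · exact le_of_mul_le_mul_left (by linarith) h

end Loewner

/-! ### Linear matrix differential equations -/

section MatrixODE

variable {m n : Type*} [Fintype m] {a t : ℝ}

theorem exists_matrixODE [Finite n] {F : ℝ → Matrix m m ℝ}
    (hF : ContinuousOn F (Ici a)) (Y₀ : Matrix m n ℝ) :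
    ∃ Y : ℝ → Matrix m n ℝ, Y a = Y₀ ∧ ∀ t, a ≤ t → HasDerivWithinAt Y (F t * Y t) (Ici a) t := by
  classical
  cases nonempty_fintype n
  exact exists_linearODE_Ici (matrixMulL.continuous.comp_continuousOn hF) Y₀

theorem isUnit_of_matrixODE [DecidableEq m] {F Y : ℝ → Matrix m m ℝ} (hF : ContinuousOn F (Ici a))
    (hY : ∀ t, a ≤ t → HasDerivWithinAt Y (F t * Y t) (Ici a) t) (h₀ : IsUnit (Y a)) (ht : a ≤ t) :
    IsUnit (Y t) := by
  obtain ⟨Z, hZa, hZ⟩ := exists_matrixODE (F := fun t => -(F t)ᵀ) (by fun_prop) ((Y a)⁻¹)ᵀ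
  have hconst := eq_of_hasDerivWithinAt_zero (f := fun τ => (Z τ)ᵀ * Y τ) (fun τ hτ =>
    (hasDerivWithinAt_matrix_mul (hasDerivWithinAt_matrix_transpose (hZ τ hτ))
      (hY τ hτ)).congr_deriv (by
        rw [transpose_mul, transpose_neg, transpose_transpose, Matrix.mul_neg, Matrix.neg_mul,
          Matrix.mul_assoc, add_neg_cancel])) ht
  rw [hZa, transpose_transpose, nonsing_inv_mul _ ((isUnit_iff_isUnit_det _).1 h₀)] at hconst
  exact IsUnit.of_mul_eq_one_right _ hconst

theorem hasDerivWithinAt_inv_of_matrixODE [DecidableEq m] {F Y : ℝ → Matrix m m ℝ}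
    {s : Set ℝ} (hY : HasDerivWithinAt Y (F t * Y t) s t) (h_unit : IsUnit (Y t)) :
    HasDerivWithinAt (fun t => (Y t)⁻¹) (-((Y t)⁻¹ * F t)) s t := by
  refine (hasDerivWithinAt_matrix_inv hY h_unit).congr_deriv ?_
  rw [Matrix.mul_assoc, Matrix.mul_assoc, mul_nonsing_inv _ ((isUnit_iff_isUnit_det _).1 h_unit),
    Matrix.mul_one]

theorem posSemidef_sub_of_hasDerivWithinAt {M M' : ℝ → Matrix m m ℝ}
    (hM : ∀ t, a ≤ t → HasDerivWithinAt M (M' t) (Ici a) t)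
    (hM' : ∀ t, a ≤ t → (M' t).PosSemidef) (ht : a ≤ t) : (M t - M a).PosSemidef := by
  classical
  have hskew : M t - (M t)ᵀ = M a - (M a)ᵀ :=
    eq_of_hasDerivWithinAt_zero (f := fun τ => M τ - (M τ)ᵀ) (fun τ hτ =>
      ((hM τ hτ).sub (hasDerivWithinAt_matrix_transpose (hM τ hτ))).congr_deriv (by
        rw [(posSemidef_iff_inner.1 (hM' τ hτ)).1, sub_self])) ht
  refine posSemidef_iff_inner.2 ⟨?_, fun x => ?_⟩
  · rw [transpose_sub, ← sub_eq_zero]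
    linear_combination (norm := abel) -hskew
  · have hform : inner ℝ x (mulVecL (M a) x) ≤ inner ℝ x (mulVecL (M t) x) :=
      le_of_hasDerivWithinAt_le (f := fun _ => inner ℝ x (mulVecL (M a) x)) (f' := fun _ => 0)
        (g := fun τ => inner ℝ x (mulVecL (M τ) x)) (g' := fun τ => inner ℝ x (mulVecL (M' τ) x))
        (fun τ _ => hasDerivWithinAt_const _ _ _)
        (fun τ hτ => ((hasDerivWithinAt_const τ _ x).inner ℝ (hasDerivWithinAt_mulVecL (hM τ hτ)
          (hasDerivWithinAt_const τ _ x))).congr_deriv (by simp))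
        le_rfl ht (fun τ hτ _ => (posSemidef_iff_inner.1 (hM' τ hτ)).2 x)
    rw [map_sub, _root_.sub_apply, inner_sub_right]
    exact sub_nonneg.2 hform

theorem posSemidef_of_lyapunovODE {F N D : ℝ → Matrix m m ℝ} (hF : ContinuousOn F (Ici a))
    (hD : ∀ t, a ≤ t → HasDerivWithinAt D (F t * D t + D t * (F t)ᵀ + N t) (Ici a) t)
    (hN : ∀ t, a ≤ t → (N t).PosSemidef) (h₀ : (D a).PosSemidef) (ht : a ≤ t) :
    (D t).PosSemidef := by
  classical
  obtain ⟨Y, hYa, hY⟩ := exists_matrixODE (F := fun t => -(F t)ᵀ) (by fun_prop) (1 : Matrix m m ℝ)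
  have hdet : IsUnit (Y t).det := (isUnit_iff_isUnit_det _).1
    (isUnit_of_matrixODE (F := fun t => -(F t)ᵀ) (by fun_prop) hY (by simp [hYa]) ht)
  have hW : ∀ τ, a ≤ τ →
      HasDerivWithinAt (fun τ => (Y τ)ᵀ * (D τ * Y τ)) ((Y τ)ᵀ * N τ * Y τ) (Ici a) τ := by
    intro τ hτ
    refine (hasDerivWithinAt_matrix_mul (hasDerivWithinAt_matrix_transpose (hY τ hτ))
      (hasDerivWithinAt_matrix_mul (hD τ hτ) (hY τ hτ))).congr_deriv ?_
    simp only [transpose_mul, transpose_neg, transpose_transpose]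
    noncomm_ring
  have hWt : ((Y t)ᵀ * (D t * Y t)).PosSemidef := by
    have h := (posSemidef_sub_of_hasDerivWithinAt hW
      (fun τ hτ => (hN τ hτ).conjTranspose_mul_mul_same (Y τ)) ht).add h₀
    simpa only [hYa, transpose_one, Matrix.one_mul, Matrix.mul_one, sub_add_cancel] using h
  have hcongr : ((Y t)⁻¹)ᵀ * ((Y t)ᵀ * (D t * Y t)) * (Y t)⁻¹ = D t := by
    rw [← Matrix.mul_assoc, ← transpose_mul, mul_nonsing_inv _ hdet, transpose_one, Matrix.one_mul,
      Matrix.mul_assoc, mul_nonsing_inv _ hdet, Matrix.mul_one]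
  exact hcongr ▸ hWt.conjTranspose_mul_mul_same (Y t)⁻¹

end MatrixODE

/-! ### The Riccati equation -/

section Riccati

variable {k p : ℕ} {a t : ℝ} {B G P : ℝ → Matrix (Fin k) (Fin k) ℝ}
  {D : ℝ → Matrix (Fin p) (Fin k) ℝ}

/-- `(U, V)` solves the Hamiltonian system `U̇ = -Bᵀ U + Dᵀ D V`, `V̇ = G U + B V` on `[a, ∞)` with
`U(a) = I` and `V(a) = P₀`; it linearizes the Riccati equation through `P = V U⁻¹`. -/
structure IsHamiltonianSolution (a : ℝ) (B : ℝ → Matrix (Fin k) (Fin k) ℝ)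
    (D : ℝ → Matrix (Fin p) (Fin k) ℝ) (G : ℝ → Matrix (Fin k) (Fin k) ℝ)
    (P₀ : Matrix (Fin k) (Fin k) ℝ) (U V : ℝ → Matrix (Fin k) (Fin k) ℝ) : Prop where
  init_U : U a = 1
  init_V : V a = P₀
  ode_U : ∀ t, a ≤ t → HasDerivWithinAt U (-(B t)ᵀ * U t + (D t)ᵀ * D t * V t) (Ici a) t
  ode_V : ∀ t, a ≤ t → HasDerivWithinAt V (G t * U t + B t * V t) (Ici a) t

theorem exists_isHamiltonianSolution (hB : ContinuousOn B (Ici a)) (hD : ContinuousOn D (Ici a))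
    (hG : ContinuousOn G (Ici a)) (P₀ : Matrix (Fin k) (Fin k) ℝ) :
    ∃ U V, IsHamiltonianSolution a B D G P₀ U V := by
  have hF : ContinuousOn (fun t => fromBlocks (-(B t)ᵀ) ((D t)ᵀ * D t) (G t) (B t)) (Ici a) :=
    (continuous_fst.fst.matrix_fromBlocks continuous_fst.snd continuous_snd.fst
      continuous_snd.snd).comp_continuousOn
        (f := fun t => ((-(B t)ᵀ, (D t)ᵀ * D t), (G t, B t))) (by fun_prop)
  obtain ⟨Y, hYa, hY⟩ := exists_matrixODE hF (fromRows 1 P₀)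
  have hY' : ∀ t, a ≤ t → HasDerivWithinAt Y
      (fromRows (-(B t)ᵀ * (Y t).toRows₁ + (D t)ᵀ * D t * (Y t).toRows₂)
        (G t * (Y t).toRows₁ + B t * (Y t).toRows₂)) (Ici a) t := fun t ht =>
    (hY t ht).congr_deriv (by rw [← fromBlocks_mul_fromRows, fromRows_toRows])
  exact ⟨fun t => (Y t).toRows₁, fun t => (Y t).toRows₂, by rw [hYa, toRows₁_fromRows],
    by rw [hYa, toRows₂_fromRows],
    fun t ht => hasDerivWithinAt_pi.2 fun i => hasDerivWithinAt_pi.1 (hY' t ht) (Sum.inl i),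
    fun t ht => hasDerivWithinAt_pi.2 fun i => hasDerivWithinAt_pi.1 (hY' t ht) (Sum.inr i)⟩

namespace IsHamiltonianSolution

variable {P₀ : Matrix (Fin k) (Fin k) ℝ} {U V : ℝ → Matrix (Fin k) (Fin k) ℝ}

theorem hasDerivWithinAt_transpose_mul (h : IsHamiltonianSolution a B D G P₀ U V) (ht : a ≤ t) :
    HasDerivWithinAt (fun t => (U t)ᵀ * V t)
      ((U t)ᵀ * G t * U t + (D t * V t)ᵀ * (D t * V t)) (Ici a) t := by
  refine (hasDerivWithinAt_matrix_mul (hasDerivWithinAt_matrix_transpose (h.ode_U t ht))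
    (h.ode_V t ht)).congr_deriv ?_
  simp only [transpose_add, transpose_mul, transpose_neg, transpose_transpose, Matrix.mul_add,
    Matrix.add_mul, Matrix.neg_mul, Matrix.mul_assoc]
  abel

theorem posDef_transpose_mul (h : IsHamiltonianSolution a B D G P₀ U V)
    (hG : ∀ t, a ≤ t → (G t).PosSemidef) (hP₀ : P₀.PosDef) (ht : a ≤ t) :
    ((U t)ᵀ * V t).PosDef := by
  have hmono : ((U t)ᵀ * V t - (U a)ᵀ * V a).PosSemidef :=
    posSemidef_sub_of_hasDerivWithinAt (fun τ hτ => h.hasDerivWithinAt_transpose_mul hτ)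
      (fun τ hτ => ((hG τ hτ).conjTranspose_mul_mul_same (U τ)).add
        (posSemidef_conjTranspose_mul_self (D τ * V τ))) ht
  rw [h.init_U, h.init_V, transpose_one, Matrix.one_mul] at hmono
  simpa only [add_sub_cancel] using hP₀.add_posSemidef hmono

theorem isUnit (h : IsHamiltonianSolution a B D G P₀ U V)
    (hG : ∀ t, a ≤ t → (G t).PosSemidef) (hP₀ : P₀.PosDef) (ht : a ≤ t) : IsUnit (U t) :=
  (isUnit_transpose _).1 (isUnit_of_mul_isUnit_left (h.posDef_transpose_mul hG hP₀ ht).isUnit)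

theorem hasDerivWithinAt_mul_inv (h : IsHamiltonianSolution a B D G P₀ U V)
    (h_unit : IsUnit (U t)) (ht : a ≤ t) :
    HasDerivWithinAt (fun t => V t * (U t)⁻¹)
      (B t * (V t * (U t)⁻¹) + V t * (U t)⁻¹ * (B t)ᵀ -
        V t * (U t)⁻¹ * (D t)ᵀ * D t * (V t * (U t)⁻¹) + G t) (Ici a) t := by
  refine (hasDerivWithinAt_matrix_mul (h.ode_V t ht)
    (hasDerivWithinAt_matrix_inv (h.ode_U t ht) h_unit)).congr_deriv ?_
  have hcancel : U t * (U t)⁻¹ = 1 := mul_nonsing_inv _ ((isUnit_iff_isUnit_det _).1 h_unit)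
  have hV : (G t * U t + B t * V t) * (U t)⁻¹ = G t + B t * (V t * (U t)⁻¹) := by
    rw [Matrix.add_mul, Matrix.mul_assoc, hcancel, Matrix.mul_one, Matrix.mul_assoc]
  have hU : (-(B t)ᵀ * U t + (D t)ᵀ * D t * V t) * (U t)⁻¹ =
      -(B t)ᵀ + (D t)ᵀ * D t * (V t * (U t)⁻¹) := by
    rw [Matrix.add_mul, Matrix.mul_assoc, hcancel, Matrix.mul_one, Matrix.mul_assoc]
  rw [hV, Matrix.mul_assoc _ _ (U t)⁻¹, hU]
  simp only [Matrix.mul_add, Matrix.mul_neg, Matrix.mul_assoc]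
  abel

theorem posDef_mul_inv (h : IsHamiltonianSolution a B D G P₀ U V)
    (hG : ∀ t, a ≤ t → (G t).PosSemidef) (hP₀ : P₀.PosDef) (ht : a ≤ t) :
    (V t * (U t)⁻¹).PosDef := by
  have hdet : IsUnit (U t).det := (isUnit_iff_isUnit_det _).1 (h.isUnit hG hP₀ ht)
  have hcongr : ((U t)⁻¹)ᵀ * ((U t)ᵀ * V t) * (U t)⁻¹ = V t * (U t)⁻¹ := by
    rw [← Matrix.mul_assoc _ (U t)ᵀ, ← transpose_mul, mul_nonsing_inv _ hdet, transpose_one,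
      Matrix.one_mul]
  rw [← hcongr]
  exact (h.posDef_transpose_mul hG hP₀ ht).conjTranspose_mul_mul_same
    (mulVec_injective_of_isUnit (isUnit_nonsing_inv_iff.2 (h.isUnit hG hP₀ ht)))

end IsHamiltonianSolution

theorem exists_isRiccatiSolution (hB : ContinuousOn B (Ici a)) (hD : ContinuousOn D (Ici a))
    (hG : ContinuousOn G (Ici a)) (hG₀ : ∀ t, a ≤ t → (G t).PosSemidef)
    {P₀ : Matrix (Fin k) (Fin k) ℝ} (hP₀ : P₀.PosDef) :
    ∃ P : ℝ → Matrix (Fin k) (Fin k) ℝ, P a = P₀ ∧ IsRiccatiSolution a B D G P ∧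
      ∀ t, a ≤ t → (P t).PosDef := by
  obtain ⟨U, V, hUV⟩ := exists_isHamiltonianSolution hB hD hG P₀
  exact ⟨fun t => V t * (U t)⁻¹, by simp [hUV.init_U, hUV.init_V],
    fun t ht => hUV.hasDerivWithinAt_mul_inv (hUV.isUnit hG₀ hP₀ ht) ht,
    fun t ht => hUV.posDef_mul_inv hG₀ hP₀ ht⟩

theorem IsRiccatiSolution.continuousOn (hP : IsRiccatiSolution a B D G P) :
    ContinuousOn P (Ici a) :=
  fun t ht => (hP t ht).continuousWithinAt

theorem IsRiccatiSolution.posSemidef_sub_of_subsolution (hP : IsRiccatiSolution a B D G P)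
    (hB : ContinuousOn B (Ici a)) (hD : ContinuousOn D (Ici a))
    (hsymm : ∀ t, a ≤ t → (P t)ᵀ = P t) {S : Matrix (Fin k) (Fin k) ℝ} (hS : Sᵀ = S)
    (hsub : ∀ t, a ≤ t → (B t * S + S * (B t)ᵀ - S * (D t)ᵀ * D t * S + G t).PosSemidef)
    (h₀ : (P a - S).PosSemidef) (ht : a ≤ t) : (P t - S).PosSemidef := by
  refine posSemidef_of_lyapunovODE (D := fun t => P t - S)
    (F := fun t => B t - (1 / 2 : ℝ) • ((P t + S) * ((D t)ᵀ * D t)))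
    (by have := hP.continuousOn; fun_prop) (fun τ hτ => ?_) hsub h₀ ht
  refine ((hP τ hτ).sub_const S).congr_deriv ?_
  simp only [transpose_sub, transpose_mul, transpose_smul, transpose_add, transpose_transpose,
    hsymm τ hτ, hS, Matrix.add_mul, Matrix.mul_add, Matrix.sub_mul, Matrix.mul_sub,
    Matrix.smul_mul, Matrix.mul_smul, Matrix.mul_assoc]
  module

theorem posSemidef_riccatiField_smul_one {β δ g q : ℝ} {B G : Matrix (Fin k) (Fin k) ℝ}
    {D : Matrix (Fin p) (Fin k) ℝ} (hB : ‖B‖ ≤ β) (hD : ‖D‖ ≤ δ)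
    (hG : (G - g • (1 : Matrix (Fin k) (Fin k) ℝ)).PosSemidef) (hq₀ : 0 ≤ q) (hq₁ : q ≤ 1)
    (hq : q * (2 * β + δ ^ 2) ≤ g) :
    (B * (q • (1 : Matrix (Fin k) (Fin k) ℝ)) + (q • (1 : Matrix (Fin k) (Fin k) ℝ)) * Bᵀ -
      (q • (1 : Matrix (Fin k) (Fin k) ℝ)) * Dᵀ * D * (q • (1 : Matrix (Fin k) (Fin k) ℝ)) +
      G).PosSemidef := by
  obtain ⟨hGs, hGx⟩ := posSemidef_sub_smul_one_iff.1 hG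
  simp only [Matrix.mul_smul, Matrix.smul_mul, Matrix.mul_one, Matrix.one_mul]
  refine posSemidef_iff_inner.2 ⟨?_, fun x => ?_⟩
  · simp only [transpose_add, transpose_sub, transpose_smul, transpose_mul, transpose_transpose,
      hGs]
    abel
  · simp only [map_add, map_sub, map_smul, _root_.add_apply, _root_.sub_apply,
      _root_.smul_apply, inner_add_right, inner_sub_right, real_inner_smul_right,
      inner_mulVecL_transpose_self, inner_mulVecL_transpose_mul_self]
    have hBx : -(β * ‖x‖ ^ 2) ≤ inner ℝ x (mulVecL B x) :=
      (abs_le.1 ((abs_inner_mulVecL_le B x).trans (by gcongr))).1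
    have hDx : ‖mulVecL D x‖ ^ 2 ≤ δ ^ 2 * ‖x‖ ^ 2 := by
      rw [← mul_pow]
      gcongr
      exact (norm_mulVecL_le D x).trans (by gcongr)
    have hqB : q * -(β * ‖x‖ ^ 2) ≤ q * inner ℝ x (mulVecL B x) := by gcongr
    have hqD : q * (q * ‖mulVecL D x‖ ^ 2) ≤ q * (1 * (δ ^ 2 * ‖x‖ ^ 2)) := by gcongr
    have hqx : q * (2 * β + δ ^ 2) * ‖x‖ ^ 2 ≤ g * ‖x‖ ^ 2 := by gcongr
    linarith [hGx x]

theorem IsRiccatiSolution.exists_lower_bound (hP : IsRiccatiSolution a B D G P)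
    (hB : ContinuousOn B (Ici a)) (hD : ContinuousOn D (Ici a)) {β δ g : ℝ}
    (hβ : ∀ t, a ≤ t → ‖B t‖ ≤ β) (hδ : ∀ t, a ≤ t → ‖D t‖ ≤ δ) (hg : 0 < g)
    (hG : ∀ t, a ≤ t → (G t - g • (1 : Matrix (Fin k) (Fin k) ℝ)).PosSemidef)
    (hpos : ∀ t, a ≤ t → (P t).PosDef) :
    ∃ q : ℝ, 0 < q ∧ ∀ t, a ≤ t → (P t - q • (1 : Matrix (Fin k) (Fin k) ℝ)).PosSemidef := by
  have hsymm : ∀ t, a ≤ t → (P t)ᵀ = P t := fun t ht => (hpos t ht).isHermitian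
  have hβ₀ : 0 ≤ β := (norm_nonneg _).trans (hβ a le_rfl)
  obtain ⟨c, hc, hPc⟩ := exists_pos_smul_one_le (hpos a le_rfl)
  set q : ℝ := min c (min 1 (g / (2 * β + δ ^ 2 + 1)))
  have hq₀ : 0 < q := lt_min hc (lt_min one_pos (by positivity))
  have hq₁ : q ≤ 1 := (min_le_right _ _).trans (min_le_left _ _)
  have hqg : q * (2 * β + δ ^ 2 + 1) ≤ g :=
    (le_div_iff₀ (by positivity)).1 ((min_le_right _ _).trans (min_le_right _ _))
  have hinit : (P a - q • (1 : Matrix (Fin k) (Fin k) ℝ)).PosSemidef :=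
    posSemidef_sub_smul_one_iff.2 ⟨hsymm a le_rfl, fun x =>
      (mul_le_mul_of_nonneg_right (min_le_left _ _) (by positivity)).trans
        ((posSemidef_sub_smul_one_iff.1 hPc).2 x)⟩
  exact ⟨q, hq₀, fun t ht => hP.posSemidef_sub_of_subsolution hB hD hsymm (by simp)
    (fun τ hτ => posSemidef_riccatiField_smul_one (hβ τ hτ) (hδ τ hτ) (hG τ hτ) hq₀.le hq₁
      (by linarith)) hinit ht⟩

end Riccati

/-! ### Upper bounds for the Riccati equation -/

section Observability

theorem norm_le_exp_mul_norm_of_inner_ge {E : Type*} [NormedAddCommGroup E]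
    [InnerProductSpace ℝ E] {s t β : ℝ} {y y' : ℝ → E}
    (hy : ∀ τ, s ≤ τ → HasDerivWithinAt y (y' τ) (Ici s) τ)
    (hβ : ∀ τ, s ≤ τ → -(β * ‖y τ‖ ^ 2) ≤ inner ℝ (y τ) (y' τ)) (hst : s ≤ t) :
    ‖y s‖ ≤ Real.exp (β * (t - s)) * ‖y t‖ := by
  have hexp : ∀ τ, HasDerivWithinAt (fun τ => Real.exp (2 * β * (τ - s)))
      (Real.exp (2 * β * (τ - s)) * (2 * β)) (Ici s) τ := fun τ => by
    simpa using (((hasDerivAt_id τ).sub_const s).const_mul (2 * β)).exp.hasDerivWithinAt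
  have hmono := le_of_hasDerivWithinAt_le (f := fun _ => ‖y s‖ ^ 2) (f' := fun _ => 0)
    (fun τ _ => hasDerivWithinAt_const _ _ _) (fun τ hτ => (hexp τ).mul (hy τ hτ).norm_sq)
    (by simp) hst fun τ hτ _ => by
      have := mul_nonneg (Real.exp_pos (2 * β * (τ - s))).le (neg_le_iff_add_nonneg.1 (hβ τ hτ))
      linarith
  refine le_of_sq_le_sq (hmono.trans_eq ?_) (by positivity)
  rw [mul_pow, ← Real.exp_nat_mul, Nat.cast_ofNat, ← mul_assoc, Pi.mul_apply]

theorem gronwallBound_zero_mul (K c ε x : ℝ) :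
    gronwallBound 0 K (ε * c) x = gronwallBound 0 K ε x * c := by
  unfold gronwallBound
  split_ifs <;> ring

variable {k p : ℕ} {a s t τ β δ : ℝ} {B G P Φ : ℝ → Matrix (Fin k) (Fin k) ℝ}
  {D : ℝ → Matrix (Fin p) (Fin k) ℝ}

/-- `Φ τ` is the state transition matrix `Φ(τ, t)` of `ż = B(τ) z`, for all `τ ≥ s`. -/
structure IsTransitionMatrix (B : ℝ → Matrix (Fin k) (Fin k) ℝ) (s t : ℝ)
    (Φ : ℝ → Matrix (Fin k) (Fin k) ℝ) : Prop where
  ode : ∀ τ, s ≤ τ → HasDerivWithinAt Φ (B τ * Φ τ) (Ici s) τ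
  nonsingular : ∀ τ, s ≤ τ → IsUnit (Φ τ)
  eq_one : Φ t = 1

theorem IsFundamentalSolution.isTransitionMatrix {X : ℝ → Matrix (Fin k) (Fin k) ℝ}
    (hX : IsFundamentalSolution B X) (hB : ContinuousOn B (Ici 0)) (hs : 0 ≤ s) (hst : s ≤ t) :
    IsTransitionMatrix B s t (fun τ => X τ * (X t)⁻¹) := by
  have h_unit : ∀ τ, s ≤ τ → IsUnit (X τ) := fun τ hτ =>
    isUnit_of_matrixODE hB hX.ode hX.nonsingular (hs.trans hτ)
  refine ⟨fun τ hτ => ?_, fun τ hτ => (h_unit τ hτ).mul (isUnit_nonsing_inv_iff.2 (h_unit t hst)),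
    mul_nonsing_inv _ ((isUnit_iff_isUnit_det _).1 (h_unit t hst))⟩
  refine (hasDerivWithinAt_matrix_mul ((hX.ode τ (hs.trans hτ)).mono (Ici_subset_Ici.2 hs))
    (hasDerivWithinAt_const τ _ (X t)⁻¹)).congr_deriv ?_
  rw [Matrix.mul_zero, zero_add, Matrix.mul_assoc]

/-- The costate `l(τ) = Φ(τ)⁻ᵀ ∫_s^τ Φᵀ Dᵀ D Φ ξ`, which the control `u = D Φ ξ` steers from `0`
along `l̇ = -Bᵀ l + Dᵀ u`. -/
noncomputable def steeredCostate (D : ℝ → Matrix (Fin p) (Fin k) ℝ)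
    (Φ : ℝ → Matrix (Fin k) (Fin k) ℝ) (s : ℝ) (ξ : EuclideanSpace ℝ (Fin k)) (τ : ℝ) :
    EuclideanSpace ℝ (Fin k) :=
  mulVecL ((Φ τ)⁻¹)ᵀ (mulVecL (∫ σ in s..τ, (Φ σ)ᵀ * (D σ)ᵀ * D σ * Φ σ) ξ)

@[simp] theorem steeredCostate_self (ξ : EuclideanSpace ℝ (Fin k)) :
    steeredCostate D Φ s ξ s = 0 := by
  simp [steeredCostate]

namespace IsTransitionMatrix

theorem continuousOn (hΦ : IsTransitionMatrix B s t Φ) : ContinuousOn Φ (Ici s) :=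
  fun τ hτ => (hΦ.ode τ hτ).continuousWithinAt

theorem steeredCostate_right (hΦ : IsTransitionMatrix B s t Φ) (ξ : EuclideanSpace ℝ (Fin k)) :
    steeredCostate D Φ s ξ t = mulVecL (∫ σ in s..t, (Φ σ)ᵀ * (D σ)ᵀ * D σ * Φ σ) ξ := by
  simp [steeredCostate, hΦ.eq_one]

theorem norm_mulVecL_le (hΦ : IsTransitionMatrix B s t Φ) (hβ : ∀ τ, s ≤ τ → ‖B τ‖ ≤ β)
    (hsτ : s ≤ τ) (hτt : τ ≤ t) (ξ : EuclideanSpace ℝ (Fin k)) :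
    ‖mulVecL (Φ τ) ξ‖ ≤ Real.exp (β * (t - s)) * ‖ξ‖ := by
  have hode : ∀ σ, τ ≤ σ → HasDerivWithinAt (fun σ => mulVecL (Φ σ) ξ)
      (mulVecL (B σ) (mulVecL (Φ σ) ξ)) (Ici τ) σ := fun σ hσ =>
    (hasDerivWithinAt_mulVecL ((hΦ.ode σ (hsτ.trans hσ)).mono (Ici_subset_Ici.2 hsτ))
      (hasDerivWithinAt_const σ _ ξ)).congr_deriv (by rw [map_zero, zero_add, mulVecL_mul])
  have hback := norm_le_exp_mul_norm_of_inner_ge hode (fun σ hσ =>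
    (abs_le.1 ((abs_inner_mulVecL_le (B σ) _).trans
      (mul_le_mul_of_nonneg_right (hβ σ (hsτ.trans hσ)) (sq_nonneg _)))).1) hτt
  rw [hΦ.eq_one, mulVecL_one] at hback
  have hβ₀ : 0 ≤ β := (norm_nonneg _).trans (hβ s le_rfl)
  exact hback.trans (by gcongr)

theorem hasDerivWithinAt_steeredCostate (hΦ : IsTransitionMatrix B s t Φ)
    (hD : ContinuousOn D (Ici s)) (ξ : EuclideanSpace ℝ (Fin k)) (hτ : s ≤ τ) :
    HasDerivWithinAt (steeredCostate D Φ s ξ)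
      (-mulVecL (B τ)ᵀ (steeredCostate D Φ s ξ τ) + mulVecL (D τ)ᵀ (mulVecL (D τ * Φ τ) ξ))
      (Ici s) τ := by
  have hgram := hasDerivWithinAt_integral_Ici
    (f := fun σ => (Φ σ)ᵀ * (D σ)ᵀ * D σ * Φ σ) (by have := hΦ.continuousOn; fun_prop) hτ
  refine (hasDerivWithinAt_mulVecL (hasDerivWithinAt_matrix_transpose
      (hasDerivWithinAt_inv_of_matrixODE (hΦ.ode τ hτ) (hΦ.nonsingular τ hτ)))
    (hasDerivWithinAt_mulVecL hgram (hasDerivWithinAt_const τ _ ξ))).congr_deriv ?_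
  have hcancel : ((Φ τ)⁻¹)ᵀ * ((Φ τ)ᵀ * (D τ)ᵀ * D τ * Φ τ) = (D τ)ᵀ * (D τ * Φ τ) := by
    simp only [← Matrix.mul_assoc]
    rw [← transpose_mul, mul_nonsing_inv _ ((isUnit_iff_isUnit_det _).1 (hΦ.nonsingular τ hτ)),
      transpose_one, Matrix.one_mul]
  rw [map_zero, zero_add, ← mulVecL_mul, hcancel, mulVecL_mul, transpose_neg, transpose_mul,
    map_neg, _root_.neg_apply, mulVecL_mul (B τ)ᵀ, add_comm, steeredCostate]

theorem norm_steeredCostate_le (hΦ : IsTransitionMatrix B s t Φ) (hD : ContinuousOn D (Ici s))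
    (hβ : ∀ τ, s ≤ τ → ‖B τ‖ ≤ β) (ξ : EuclideanSpace ℝ (Fin k)) {μ : ℝ}
    (hμ : ∀ τ, s ≤ τ → τ ≤ t → ‖mulVecL (D τ)ᵀ (mulVecL (D τ * Φ τ) ξ)‖ ≤ μ)
    (hsτ : s ≤ τ) (hτt : τ ≤ t) :
    ‖steeredCostate D Φ s ξ τ‖ ≤ gronwallBound 0 β μ (t - s) := by
  have hβ₀ : 0 ≤ β := (norm_nonneg _).trans (hβ s le_rfl)
  have hμ₀ : 0 ≤ μ := (norm_nonneg _).trans (hμ τ hsτ hτt)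
  refine (norm_le_gronwallBound_of_norm_deriv_right_le (δ := 0) (K := β) (ε := μ)
    (fun σ hσ => (hΦ.hasDerivWithinAt_steeredCostate hD ξ hσ.1).continuousWithinAt.mono
      Icc_subset_Ici_self)
    (fun σ hσ => (hΦ.hasDerivWithinAt_steeredCostate hD ξ hσ.1).mono (Ici_subset_Ici.2 hσ.1))
    (by simp) (fun σ hσ => ?_) τ ⟨hsτ, hτt⟩).trans
    (gronwallBound_mono le_rfl hμ₀ hβ₀ (by gcongr))
  refine (norm_add_le _ _).trans (add_le_add ?_ (hμ σ hσ.1 hσ.2.le))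
  rw [norm_neg]
  refine (_root_.norm_mulVecL_le _ _).trans ?_
  rw [l2_opNorm_transpose]
  gcongr
  exact hβ σ hσ.1

end IsTransitionMatrix

/-- Completing the square: `d/dτ ⟨l, P l⟩ = ⟨l, G l⟩ + ‖u‖² - ‖u - D P l‖²`. -/
theorem IsRiccatiSolution.inner_le_cost (hP : IsRiccatiSolution a B D G P)
    (hsymm : ∀ t, a ≤ t → (P t)ᵀ = P t) (has : a ≤ s) (hst : s ≤ t)
    {l : ℝ → EuclideanSpace ℝ (Fin k)} {u : ℝ → EuclideanSpace ℝ (Fin p)} {c : ℝ}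
    (hl : ∀ τ, s ≤ τ →
      HasDerivWithinAt l (-mulVecL (B τ)ᵀ (l τ) + mulVecL (D τ)ᵀ (u τ)) (Ici s) τ)
    (hls : l s = 0)
    (hc : ∀ τ, s ≤ τ → τ ≤ t → inner ℝ (l τ) (mulVecL (G τ) (l τ)) + ‖u τ‖ ^ 2 ≤ c) :
    inner ℝ (l t) (mulVecL (P t) (l t)) ≤ c * (t - s) := by
  refine le_of_hasDerivWithinAt_le (f := fun τ => inner ℝ (l τ) (mulVecL (P τ) (l τ)))
    (f' := fun τ => inner ℝ (l τ) (mulVecL (G τ) (l τ)) + ‖u τ‖ ^ 2 -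
      ‖u τ - mulVecL (D τ) (mulVecL (P τ) (l τ))‖ ^ 2)
    (g := fun τ => c * (τ - s)) (g' := fun _ => c) (fun τ hτ => ?_)
    (fun τ _ => by simpa using (((hasDerivAt_id τ).sub_const s).const_mul c).hasDerivWithinAt)
    (by simp [hls]) hst fun τ hsτ hτt => (sub_le_self _ (sq_nonneg _)).trans (hc τ hsτ hτt)
  refine ((hl τ hτ).inner ℝ (hasDerivWithinAt_mulVecL
    ((hP τ (has.trans hτ)).mono (Ici_subset_Ici.2 has)) (hl τ hτ))).congr_deriv ?_
  set w := mulVecL (P τ) (l τ) with hw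
  have hPx : ∀ x, inner ℝ (l τ) (mulVecL (P τ) x) = inner ℝ w x := fun x => by
    rw [inner_mulVecL_right, hsymm τ (has.trans hτ)]
  have hDw : inner ℝ w (mulVecL (D τ)ᵀ (mulVecL (D τ) w)) = ‖mulVecL (D τ) w‖ ^ 2 := by
    rw [← inner_mulVecL_left, real_inner_self_eq_norm_sq]
  have hBl : inner ℝ (mulVecL (B τ)ᵀ (l τ)) w = inner ℝ (l τ) (mulVecL (B τ) w) :=
    (inner_mulVecL_right _ _ _).symm
  have hDu : inner ℝ (mulVecL (D τ)ᵀ (u τ)) w = inner ℝ (u τ) (mulVecL (D τ) w) :=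
    (inner_mulVecL_right _ _ _).symm
  have huD : inner ℝ w (mulVecL (D τ)ᵀ (u τ)) = inner ℝ (u τ) (mulVecL (D τ) w) := by
    rw [real_inner_comm, hDu]
  rw [norm_sub_sq_real]
  simp only [map_add, map_sub, map_neg, _root_.add_apply, _root_.sub_apply, mulVecL_mul,
    inner_add_right, inner_sub_right, inner_neg_right, hPx, inner_add_left, inner_neg_left,
    ← hw, hDw, hBl, hDu, huD]
  ring

theorem IsRiccatiSolution.inner_gramian_le (hP : IsRiccatiSolution a B D G P)
    (hsymm : ∀ t, a ≤ t → (P t)ᵀ = P t) (hΦ : IsTransitionMatrix B s t Φ) (has : a ≤ s)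
    (hst : s ≤ t) (hD : ContinuousOn D (Ici s)) (hβ : ∀ τ, s ≤ τ → ‖B τ‖ ≤ β)
    (hδ : ∀ τ, s ≤ τ → ‖D τ‖ ≤ δ) {g : ℝ} (hg : 0 ≤ g)
    (hG : ∀ t, a ≤ t → (g • (1 : Matrix (Fin k) (Fin k) ℝ) - G t).PosSemidef)
    {W : Matrix (Fin k) (Fin k) ℝ} (hW : ∫ σ in s..t, (Φ σ)ᵀ * (D σ)ᵀ * D σ * Φ σ = W)
    (ξ : EuclideanSpace ℝ (Fin k)) :
    inner ℝ (mulVecL W ξ) (mulVecL (P t) (mulVecL W ξ)) ≤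
      (g * gronwallBound 0 β (δ * (δ * Real.exp (β * (t - s)))) (t - s) ^ 2 +
        (δ * Real.exp (β * (t - s))) ^ 2) * (t - s) * ‖ξ‖ ^ 2 := by
  have hδ₀ : 0 ≤ δ := (norm_nonneg _).trans (hδ s le_rfl)
  set η := Real.exp (β * (t - s))
  have hu : ∀ τ, s ≤ τ → τ ≤ t → ‖mulVecL (D τ * Φ τ) ξ‖ ≤ δ * η * ‖ξ‖ := fun τ hsτ hτt => by
    rw [mulVecL_mul, mul_assoc]
    exact (norm_mulVecL_le _ _).trans
      (mul_le_mul (hδ τ hsτ) (hΦ.norm_mulVecL_le hβ hsτ hτt ξ) (norm_nonneg _) hδ₀)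
  have hforce : ∀ τ, s ≤ τ → τ ≤ t →
      ‖mulVecL (D τ)ᵀ (mulVecL (D τ * Φ τ) ξ)‖ ≤ δ * (δ * η) * ‖ξ‖ := fun τ hsτ hτt => by
    rw [mul_assoc δ]
    refine (norm_mulVecL_le _ _).trans (mul_le_mul ?_ (hu τ hsτ hτt) (norm_nonneg _) hδ₀)
    exact (l2_opNorm_transpose (D τ)).trans_le (hδ τ hsτ)
  have hcost := hP.inner_le_cost hsymm has hst
    (fun τ hτ => hΦ.hasDerivWithinAt_steeredCostate hD ξ hτ) (steeredCostate_self ξ)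
    (c := (g * gronwallBound 0 β (δ * (δ * η)) (t - s) ^ 2 + (δ * η) ^ 2) * ‖ξ‖ ^ 2)
    fun τ hsτ hτt => by
      have hl := hΦ.norm_steeredCostate_le hD hβ ξ hforce hsτ hτt
      rw [gronwallBound_zero_mul] at hl
      calc _ ≤ g * ‖steeredCostate D Φ s ξ τ‖ ^ 2 + ‖mulVecL (D τ * Φ τ) ξ‖ ^ 2 := by
            gcongr
            exact (posSemidef_smul_one_sub_iff.1 (hG τ (has.trans hsτ))).2 _
        _ ≤ g * (gronwallBound 0 β (δ * (δ * η)) (t - s) * ‖ξ‖) ^ 2 + (δ * η * ‖ξ‖) ^ 2 := by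
            gcongr
            exact hu τ hsτ hτt
        _ = _ := by ring
  rw [hΦ.steeredCostate_right, hW] at hcost
  exact hcost.trans_eq (by ring)

theorem IsRiccatiSolution.exists_upper_bound_of_isCompact (hP : IsRiccatiSolution a B D G P)
    (hsymm : ∀ t, a ≤ t → (P t)ᵀ = P t) (b : ℝ) :
    ∃ c : ℝ, 0 ≤ c ∧
      ∀ t ∈ Icc a b, (c • (1 : Matrix (Fin k) (Fin k) ℝ) - P t).PosSemidef := by
  obtain ⟨c, hc⟩ := isCompact_Icc.exists_bound_of_continuousOn
    (hP.continuousOn.mono (Icc_subset_Ici_self : Icc a b ⊆ Ici a))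
  exact ⟨max c 0, le_max_right _ _, fun t ht =>
    posSemidef_smul_one_sub_of_norm_le (hsymm t ht.1) ((hc t ht).trans (le_max_left _ _))⟩

theorem IsRiccatiSolution.exists_upper_bound (hP : IsRiccatiSolution a B D G P) (ha : 0 ≤ a)
    (hsymm : ∀ t, a ≤ t → (P t)ᵀ = P t) (hB : ContinuousOn B (Ici 0)) (hD : ContinuousOn D (Ici 0))
    (hβ : ∀ t, 0 ≤ t → ‖B t‖ ≤ β) (hδ : ∀ t, 0 ≤ t → ‖D t‖ ≤ δ) {g : ℝ} (hg : 0 ≤ g)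
    (hG : ∀ t, a ≤ t → (g • (1 : Matrix (Fin k) (Fin k) ℝ) - G t).PosSemidef)
    (hobs : IsUniformlyCompletelyObservable B D) :
    ∃ q : ℝ, 0 < q ∧ ∀ t, a ≤ t → (q • (1 : Matrix (Fin k) (Fin k) ℝ) - P t).PosSemidef := by
  obtain ⟨X, hX, α, _, T, hα, -, hT, hgram⟩ := hobs
  obtain ⟨c, hc₀, hc⟩ := hP.exists_upper_bound_of_isCompact hsymm (a + T)
  set κ : ℝ := (g * gronwallBound 0 β (δ * (δ * Real.exp (β * T))) T ^ 2 +
    (δ * Real.exp (β * T)) ^ 2) * T with hκ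
  refine ⟨c + κ * α⁻¹ ^ 2 + 1, by positivity, fun t ht =>
    posSemidef_smul_one_sub_iff.2 ⟨hsymm t ht, fun v => ?_⟩⟩
  suffices inner ℝ v (mulVecL (P t) v) ≤ (c + κ * α⁻¹ ^ 2) * ‖v‖ ^ 2 by
    linarith [sq_nonneg ‖v‖]
  rcases le_total t (a + T) with htT | htT
  · refine ((posSemidef_smul_one_sub_iff.1 (hc t ⟨ht, htT⟩)).2 v).trans ?_
    gcongr
    exact le_add_of_nonneg_right (by positivity)
  obtain ⟨s, rfl⟩ : ∃ s, t = s + T := ⟨t - T, (sub_add_cancel t T).symm⟩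
  have has : a ≤ s := by linarith
  have hs : 0 ≤ s := ha.trans has
  have hst : s ≤ s + T := by linarith
  set W := constructibilityGramian X D (s + T) s
  have hW : (W - α • (1 : Matrix (Fin k) (Fin k) ℝ)).PosSemidef := (hgram s hs).1
  have hW_pos : W.PosDef := posDef_of_posSemidef_sub_smul_one hα hW
  have hξ : ‖mulVecL W⁻¹ v‖ ≤ α⁻¹ * ‖v‖ := (norm_mulVecL_le _ _).trans (by
    gcongr
    exact norm_le_of_posDef hW_pos.inv (inv_pos.2 hα) (inv_le_inv_smul_one hα hW))
  have hcost := hP.inner_gramian_le hsymm (hX.isTransitionMatrix hB hs hst) has hst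
    (hD.mono (Ici_subset_Ici.2 hs)) (fun τ hτ => hβ τ (hs.trans hτ))
    (fun τ hτ => hδ τ (hs.trans hτ)) hg hG rfl (mulVecL W⁻¹ v)
  rw [add_sub_cancel_left, ← hκ] at hcost
  change inner ℝ (mulVecL W _) (mulVecL _ (mulVecL W _)) ≤ _ at hcost
  rw [mulVecL_mulVecL_inv hW_pos.isUnit] at hcost
  calc inner ℝ v (mulVecL (P (s + T)) v) ≤ κ * ‖mulVecL W⁻¹ v‖ ^ 2 := hcost
    _ ≤ κ * (α⁻¹ * ‖v‖) ^ 2 := by gcongr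
    _ = κ * α⁻¹ ^ 2 * ‖v‖ ^ 2 := by ring
    _ ≤ (c + κ * α⁻¹ ^ 2) * ‖v‖ ^ 2 := by
      gcongr
      exact le_add_of_nonneg_left hc₀

theorem exists_isRiccatiSolution_loewnerBounds (ha : 0 ≤ a) (hB : ContinuousOn B (Ici 0))
    (hD : ContinuousOn D (Ici 0)) (hβ : ∀ t, 0 ≤ t → ‖B t‖ ≤ β) (hδ : ∀ t, 0 ≤ t → ‖D t‖ ≤ δ)
    (hobs : IsUniformlyCompletelyObservable B D) (hGc : ContinuousOn G (Ici a)) {g₁ g₂ : ℝ}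
    (hg₁ : 0 < g₁) (hg₂ : 0 < g₂) (hG : LoewnerBounds a g₁ g₂ G)
    {P₀ : Matrix (Fin k) (Fin k) ℝ} (hP₀ : P₀.PosDef) :
    ∃ P p₁ p₂, P a = P₀ ∧ IsRiccatiSolution a B D G P ∧ 0 < p₁ ∧ 0 < p₂ ∧
      LoewnerBounds a p₁ p₂ P := by
  have hBa := hB.mono (Ici_subset_Ici.2 ha)
  have hDa := hD.mono (Ici_subset_Ici.2 ha)
  obtain ⟨P, hPa, hP, hpos⟩ := exists_isRiccatiSolution hBa hDa hGc
    (fun t ht => (posDef_of_posSemidef_sub_smul_one hg₁ (hG t ht).1).posSemidef) hP₀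
  obtain ⟨p₁, hp₁, hlow⟩ := hP.exists_lower_bound hBa hDa (fun t ht => hβ t (ha.trans ht))
    (fun t ht => hδ t (ha.trans ht)) hg₁ (fun t ht => (hG t ht).1) hpos
  obtain ⟨p₂, hp₂, hup⟩ := hP.exists_upper_bound ha (fun t ht => (hpos t ht).isHermitian) hB hD
    hβ hδ hg₂.le (fun t ht => (hG t ht).2) hobs
  exact ⟨P, p₁, p₂, hPa, hP, hp₁, hp₂, fun t ht => ⟨hlow t ht, hup t ht⟩⟩

end Observability

/-! ### Exponential decay -/

theorem le_exp_integral_mul_add_of_deriv_le {b V V' : ℝ → ℝ} {s t c K M γ : ℝ}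
    (hb : ContinuousOn b (Ici s)) (hst : s ≤ t) (hγ : γ < c) (hM : 0 ≤ M)
    (hint : ∀ τ, s ≤ τ → τ ≤ t → ∫ σ in τ..t, b σ ≤ K - c * (t - τ))
    (hV : ∀ τ, s ≤ τ → HasDerivWithinAt V (V' τ) (Ici s) τ)
    (hV' : ∀ τ, s ≤ τ → V' τ ≤ b τ * V τ + M * Real.exp (-γ * (τ - s))) :
    V t ≤ Real.exp (∫ σ in s..t, b σ) * V s +
      Real.exp K * (M / (c - γ)) * Real.exp (-γ * (t - s)) := by
  have hcγ : 0 < c - γ := sub_pos.2 hγ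
  set E : ℝ → ℝ := fun τ => ∫ σ in s..τ, b σ with hEdef
  have hE : ∀ τ, s ≤ τ → τ ≤ t → E t - E τ ≤ K - c * (t - τ) := fun τ hsτ hτt => by
    have hbint : ∀ {r}, s ≤ r → IntervalIntegrable b MeasureTheory.volume s r := fun hr =>
      (hb.mono (uIcc_of_le hr ▸ Icc_subset_Ici_self)).intervalIntegrable
    rw [hEdef, intervalIntegral.integral_interval_sub_left (hbint hst) (hbint hsτ)]
    exact hint τ hsτ hτt
  have hW : ∀ τ, s ≤ τ → HasDerivWithinAt (fun τ => Real.exp (E t - E τ) * V τ)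
      (Real.exp (E t - E τ) * (V' τ - b τ * V τ)) (Ici s) τ := fun τ hτ =>
    ((((hasDerivWithinAt_integral_Ici hb hτ).const_sub (E t)).exp).mul (hV τ hτ)).congr_deriv
      (by ring)
  have hg : ∀ τ, s ≤ τ → HasDerivWithinAt (fun τ => Real.exp (E t - E s) * V s +
      Real.exp K * (M / (c - γ)) * Real.exp (-c * (t - τ) + -γ * (τ - s)))
      (Real.exp K * M * Real.exp (-c * (t - τ) + -γ * (τ - s))) (Ici s) τ := fun τ _ => by
    have hexponent : HasDerivAt (fun τ : ℝ => -c * (t - τ) + -γ * (τ - s)) (c - γ) τ :=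
      ((((hasDerivAt_id τ).const_sub t).const_mul (-c)).add
        (((hasDerivAt_id τ).sub_const s).const_mul (-γ))).congr_deriv (by ring)
    refine ((hexponent.exp.const_mul _).const_add _).hasDerivWithinAt.congr_deriv ?_
    field_simp
  have hmain := le_of_hasDerivWithinAt_le hW hg
    (le_add_of_nonneg_right (by positivity)) hst fun τ hsτ hτt => calc
      Real.exp (E t - E τ) * (V' τ - b τ * V τ)
        ≤ Real.exp (E t - E τ) * (M * Real.exp (-γ * (τ - s))) :=
          mul_le_mul_of_nonneg_left (by linarith [hV' τ hsτ]) (Real.exp_nonneg _)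
      _ ≤ Real.exp (K - c * (t - τ)) * (M * Real.exp (-γ * (τ - s))) :=
          mul_le_mul_of_nonneg_right (Real.exp_le_exp.2 (hE τ hsτ hτt)) (by positivity)
      _ = Real.exp K * M * Real.exp (-c * (t - τ) + -γ * (τ - s)) := by
          rw [sub_eq_add_neg, ← neg_mul, Real.exp_add, Real.exp_add]; ring
  simpa [hEdef] using hmain

theorem le_exp_of_deriv_le_mul_add_exp {b V V' : ℝ → ℝ} {s t c K M γ : ℝ}
    (hb : ContinuousOn b (Ici s)) (hst : s ≤ t) (hγ : γ < c) (hM : 0 ≤ M)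
    (hint : ∀ τ, s ≤ τ → τ ≤ t → ∫ σ in τ..t, b σ ≤ K - c * (t - τ))
    (hV : ∀ τ, s ≤ τ → HasDerivWithinAt V (V' τ) (Ici s) τ)
    (hV' : ∀ τ, s ≤ τ → V' τ ≤ b τ * V τ + M * Real.exp (-γ * (τ - s))) :
    V t ≤ Real.exp K * (|V s| + M / (c - γ)) * Real.exp (-γ * (t - s)) := by
  have hinit : Real.exp (∫ σ in s..t, b σ) ≤ Real.exp K * Real.exp (-γ * (t - s)) := by
    rw [← Real.exp_add, Real.exp_le_exp]
    linarith [hint s le_rfl hst, mul_le_mul_of_nonneg_right hγ.le (sub_nonneg.2 hst)]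
  calc V t ≤ Real.exp (∫ σ in s..t, b σ) * V s +
        Real.exp K * (M / (c - γ)) * Real.exp (-γ * (t - s)) :=
        le_exp_integral_mul_add_of_deriv_le hb hst hγ hM hint hV hV'
    _ ≤ Real.exp K * Real.exp (-γ * (t - s)) * |V s| +
        Real.exp K * (M / (c - γ)) * Real.exp (-γ * (t - s)) := by
        gcongr ?_ + _
        exact (mul_le_mul_of_nonneg_left (le_abs_self _) (Real.exp_nonneg _)).trans
          (mul_le_mul_of_nonneg_right hinit (abs_nonneg _))
    _ = Real.exp K * (|V s| + M / (c - γ)) * Real.exp (-γ * (t - s)) := by ring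

theorem abs_le_exp_of_deriv_eq_mul_add {b x h : ℝ → ℝ} {s t c K M γ : ℝ}
    (hb : ContinuousOn b (Ici s)) (hst : s ≤ t) (hγ : γ < c)
    (hint : ∀ τ, s ≤ τ → τ ≤ t → ∫ σ in τ..t, b σ ≤ K - c * (t - τ))
    (hx : ∀ τ, s ≤ τ → HasDerivWithinAt x (b τ * x τ + h τ) (Ici s) τ)
    (hh : ∀ τ, s ≤ τ → |h τ| ≤ M * Real.exp (-γ * (τ - s))) :
    |x t| ≤ Real.exp K * (|x s| + M / (c - γ)) * Real.exp (-γ * (t - s)) := by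
  have hM : 0 ≤ M := by simpa using (abs_nonneg _).trans (hh s le_rfl)
  refine abs_le'.2 ⟨?_, ?_⟩
  · exact le_exp_of_deriv_le_mul_add_exp hb hst hγ hM hint hx fun τ hτ => by
      linarith [le_of_abs_le (hh τ hτ)]
  · rw [← abs_neg (x s)]
    exact le_exp_of_deriv_le_mul_add_exp hb hst hγ hM hint (fun τ hτ => (hx τ hτ).neg)
      fun τ hτ => by
        rw [Pi.neg_apply, mul_neg]
        linarith [neg_le_of_abs_le (hh τ hτ)]

theorem exists_eventual_integral_le_of_upperBohlExponent_neg {b : ℝ → ℝ}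
    (h : upperBohlExponent b < 0) :
    ∃ c s₀ H₀ : ℝ, 0 < c ∧ 0 ≤ s₀ ∧ 0 ≤ H₀ ∧
      ∀ s t, s₀ ≤ s → s + H₀ ≤ t → ∫ τ in s..t, b τ ≤ -c * (t - s) := by
  obtain ⟨x, hbx, hx⟩ := EReal.lt_iff_exists_real_btwn.1 h
  have hev := Filter.eventually_lt_of_limsup_lt hbx
  rw [Filter.prod_atTop_atTop_eq, Filter.eventually_atTop] at hev
  obtain ⟨⟨s₀, H₀⟩, hev⟩ := hev
  refine ⟨-x, max s₀ 0, max H₀ 1, neg_pos.2 (by exact_mod_cast hx), le_max_right _ _,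
    zero_le_one.trans (le_max_right _ _), fun s t hs ht => ?_⟩
  have hts : max H₀ 1 ≤ t - s := le_sub_iff_add_le'.2 ht
  have havg := hev (s, t - s) ⟨(le_max_left _ _).trans hs, (le_max_left _ _).trans hts⟩
  rw [EReal.coe_lt_coe_iff, add_sub_cancel,
    inv_mul_lt_iff₀ (one_pos.trans_le ((le_max_right _ _).trans hts))] at havg
  linarith

theorem exists_integral_le_of_upperBohlExponent_neg {b : ℝ → ℝ} (hb : ContinuousOn b (Ici 0))
    {M : ℝ} (hM : ∀ t, 0 ≤ t → b t ≤ M) (h : upperBohlExponent b < 0) :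
    ∃ c K : ℝ, 0 < c ∧ ∀ s t, 0 ≤ s → s ≤ t → ∫ τ in s..t, b τ ≤ K - c * (t - s) := by
  obtain ⟨c, s₀, H₀, hc, hs₀, hH₀, hlong⟩ := exists_eventual_integral_le_of_upperBohlExponent_neg h
  have hint : ∀ {s t}, 0 ≤ s → s ≤ t → IntervalIntegrable b MeasureTheory.volume s t :=
    fun hs hst => (hb.mono fun _ hτ => hs.trans (uIcc_of_le hst ▸ hτ).1).intervalIntegrable
  have hshort : ∀ s t, 0 ≤ s → s ≤ t → ∫ τ in s..t, b τ ≤ max M 0 * (t - s) := fun s t hs hst => by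
    have := intervalIntegral.integral_mono_on hst (hint hs hst)
      (intervalIntegrable_const (c := max M 0))
      fun τ hτ => (hM τ (hs.trans hτ.1)).trans (le_max_left _ _)
    rwa [intervalIntegral.integral_const, smul_eq_mul, mul_comm] at this
  have hL : 0 ≤ max M 0 := le_max_right _ _
  refine ⟨c, (max M 0 + c) * (s₀ + H₀), hc, fun s t hs hst => ?_⟩
  have hstart : max s s₀ - s ≤ s₀ + H₀ := by rcases max_cases s s₀ with h | h <;> linarith
  rcases le_total (max s s₀ + H₀) t with ht | ht
  · have hss₀ : 0 ≤ max s s₀ := hs.trans (le_max_left _ _)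
    have hs₀t : max s s₀ ≤ t := (le_add_of_nonneg_right hH₀).trans ht
    rw [← intervalIntegral.integral_add_adjacent_intervals (hint hs (le_max_left _ _))
      (hint hss₀ hs₀t)]
    linarith [hshort s _ hs (le_max_left s s₀), hlong _ t (le_max_right _ _) ht,
      mul_le_mul_of_nonneg_left hstart (add_nonneg hL hc.le)]
  · have hlen : t - s ≤ s₀ + H₀ := by rcases max_cases s s₀ with h | h <;> linarith
    linarith [hshort s t hs hst, mul_le_mul_of_nonneg_left hlen (add_nonneg hL hc.le)]

section DecaysAlong

variable {n : ℕ} {a : ℝ} {F : ℝ → Matrix (Fin n) (Fin n) ℝ}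

theorem IsSolutionFrom.hasDerivWithinAt_apply {s : ℝ} {x : ℝ → EuclideanSpace ℝ (Fin n)}
    (hx : IsSolutionFrom F s x) (i : Fin n) {t : ℝ} (ht : s ≤ t) :
    HasDerivWithinAt (fun τ => x τ i) (∑ l, F t i l * x t l) (Ici s) t :=
  (EuclideanSpace.proj (𝕜 := ℝ) i).hasFDerivAt.comp_hasDerivWithinAt t (hx t ht)

/-- The functional `f` decays exponentially along the solutions of `ẋ = F(t) x`, uniformly in the
initial time `s ≥ a`. With `f = id` and `K ≥ 1` this is uniform exponential stability. -/
def DecaysAlong {E : Type*} [Norm E] (a : ℝ) (F : ℝ → Matrix (Fin n) (Fin n) ℝ)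
    (f : EuclideanSpace ℝ (Fin n) → E) : Prop :=
  ∃ μ K : ℝ, 0 < μ ∧ 0 ≤ K ∧ ∀ s, a ≤ s → ∀ x, IsSolutionFrom F s x → ∀ t, s ≤ t →
    ‖f (x t)‖ ≤ K * Real.exp (-μ * (t - s)) * ‖x s‖

theorem DecaysAlong.of_norm_le {E E' : Type*} [Norm E] [Norm E']
    {f : EuclideanSpace ℝ (Fin n) → E} {g : EuclideanSpace ℝ (Fin n) → E'}
    (hf : DecaysAlong a F f) (hgf : ∀ x, ‖g x‖ ≤ ‖f x‖) : DecaysAlong a F g := by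
  obtain ⟨μ, K, hμ, hK, h⟩ := hf
  exact ⟨μ, K, hμ, hK, fun s hs x hx t ht => (hgf _).trans (h s hs x hx t ht)⟩

theorem DecaysAlong.add {E : Type*} [SeminormedAddGroup E] {f g : EuclideanSpace ℝ (Fin n) → E}
    (hf : DecaysAlong a F f) (hg : DecaysAlong a F g) : DecaysAlong a F (f + g) := by
  obtain ⟨μ, K, hμ, hK, hf⟩ := hf
  obtain ⟨ν, L, hν, hL, hg⟩ := hg
  refine ⟨min μ ν, K + L, lt_min hμ hν, add_nonneg hK hL, fun s hs x hx t ht => ?_⟩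
  calc ‖f (x t) + g (x t)‖ ≤ ‖f (x t)‖ + ‖g (x t)‖ := norm_add_le _ _
    _ ≤ K * Real.exp (-μ * (t - s)) * ‖x s‖ + L * Real.exp (-ν * (t - s)) * ‖x s‖ :=
        add_le_add (hf s hs x hx t ht) (hg s hs x hx t ht)
    _ ≤ K * Real.exp (-min μ ν * (t - s)) * ‖x s‖ + L * Real.exp (-min μ ν * (t - s)) * ‖x s‖ := by
        gcongr
        exacts [min_le_left _ _, min_le_right _ _]
    _ = (K + L) * Real.exp (-min μ ν * (t - s)) * ‖x s‖ := by ring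

theorem DecaysAlong.sum {E ι : Type*} [SeminormedAddCommGroup E] {S : Finset ι}
    {f : ι → EuclideanSpace ℝ (Fin n) → E} (hf : ∀ i ∈ S, DecaysAlong a F (f i)) :
    DecaysAlong a F (∑ i ∈ S, f i) := by
  classical
  refine Finset.sum_induction f (DecaysAlong a F) (fun _ _ => DecaysAlong.add) ?_ hf
  exact ⟨1, 0, one_pos, le_rfl, fun s _ x _ t _ => by simp⟩

theorem DecaysAlong.isUniformlyExponentiallyStable (h : DecaysAlong a F id) :
    IsUniformlyExponentiallyStable a F := by
  obtain ⟨μ, K, hμ, -, h⟩ := h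
  refine ⟨μ, max K 1, hμ, le_max_right _ _, fun s hs x hx t ht => (h s hs x hx t ht).trans ?_⟩
  gcongr
  exact le_max_left _ _

theorem sum_eq_add_sum_Ioi_of_forall_lt {ι M : Type*} [Fintype ι] [LinearOrder ι]
    [LocallyFiniteOrderTop ι] [AddCommMonoid M] {i : ι} {f : ι → M} (hf : ∀ l < i, f l = 0) :
    ∑ l, f l = f i + ∑ l ∈ Finset.Ioi i, f l := by
  rw [← Finset.sum_subset (Finset.subset_univ (Finset.Ici i)) fun l _ hl =>
      hf l (by simpa using hl), ← Finset.Ioi_insert, Finset.sum_insert Finset.notMem_Ioi_self]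

theorem decaysAlong_apply_of_row {β : ℝ} {i : Fin n}
    (hcont : ContinuousOn (fun t => F t i i) (Ici a)) (hβ : ∀ t, a ≤ t → ∀ l, |F t i l| ≤ β)
    (hlow : ∀ t, a ≤ t → ∀ l < i, F t i l = 0)
    (hdiag : ∃ c K : ℝ, 0 < c ∧ ∀ s t, a ≤ s → s ≤ t → ∫ τ in s..t, F τ i i ≤ K - c * (t - s))
    (hright : ∀ l > i, DecaysAlong a F (fun x => x l)) : DecaysAlong a F (fun x => x i) := by
  obtain ⟨μ, L, hμ, hL, hsum⟩ : DecaysAlong a F (∑ l ∈ Finset.Ioi i, fun x => |x l|) :=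
    DecaysAlong.sum fun l hl => (hright l (Finset.mem_Ioi.1 hl)).of_norm_le fun x => by
      rw [norm_abs_eq_norm]
  obtain ⟨c, K, hc, hint⟩ := hdiag
  have hβ₀ : 0 ≤ β := (abs_nonneg _).trans (hβ a le_rfl i)
  have hγc : min μ (c / 2) < c := (min_le_right _ _).trans_lt (half_lt_self hc)
  have : 0 < c - min μ (c / 2) := sub_pos.2 hγc
  refine ⟨min μ (c / 2), Real.exp K * (1 + β * L / (c - min μ (c / 2))), lt_min hμ (half_pos hc),
    by positivity, fun s hs x hx t ht => ?_⟩
  have hforce : ∀ τ, s ≤ τ → |∑ l ∈ Finset.Ioi i, F τ i l * x τ l| ≤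
      β * L * ‖x s‖ * Real.exp (-min μ (c / 2) * (τ - s)) := fun τ hτ => calc
    _ ≤ ∑ l ∈ Finset.Ioi i, β * |x τ l| := (Finset.abs_sum_le_sum_abs _ _).trans <|
        Finset.sum_le_sum fun l _ => by
          rw [abs_mul]
          exact mul_le_mul_of_nonneg_right (hβ τ (hs.trans hτ) l) (abs_nonneg _)
    _ ≤ β * (L * Real.exp (-μ * (τ - s)) * ‖x s‖) := by
        rw [← Finset.mul_sum]
        refine mul_le_mul_of_nonneg_left ((le_abs_self _).trans ?_) hβ₀
        simpa only [Finset.sum_apply, Real.norm_eq_abs] using hsum s hs x hx τ hτ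
    _ ≤ β * (L * Real.exp (-min μ (c / 2) * (τ - s)) * ‖x s‖) := by
        gcongr
        exact min_le_left _ _
    _ = _ := by ring
  calc ‖x t i‖ ≤ Real.exp K * (|x s i| + β * L * ‖x s‖ / (c - min μ (c / 2))) *
        Real.exp (-min μ (c / 2) * (t - s)) :=
        abs_le_exp_of_deriv_eq_mul_add (hcont.mono (Ici_subset_Ici.2 hs)) ht hγc
          (fun τ hτ hτt => hint τ t (hs.trans hτ) hτt)
          (fun τ hτ => (hx.hasDerivWithinAt_apply i hτ).congr_deriv <|
            sum_eq_add_sum_Ioi_of_forall_lt fun l hl => by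
              rw [hlow τ (hs.trans hτ) l hl, zero_mul]) hforce
    _ ≤ Real.exp K * (‖x s‖ + β * L * ‖x s‖ / (c - min μ (c / 2))) *
        Real.exp (-min μ (c / 2) * (t - s)) := by
        gcongr
        exact PiLp.norm_apply_le (x s) i
    _ = _ := by ring

theorem decaysAlong_apply_of_upperTriangular {β : ℝ} {S : Set (Fin n)} (hS : IsUpperSet S)
    (hcont : ∀ i ∈ S, ContinuousOn (fun t => F t i i) (Ici a))
    (hβ : ∀ t, a ≤ t → ∀ i ∈ S, ∀ l, |F t i l| ≤ β)
    (hlow : ∀ t, a ≤ t → ∀ i ∈ S, ∀ l < i, F t i l = 0)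
    (hdiag : ∀ i ∈ S, ∃ c K : ℝ, 0 < c ∧
      ∀ s t, a ≤ s → s ≤ t → ∫ τ in s..t, F τ i i ≤ K - c * (t - s))
    {i : Fin n} (hi : i ∈ S) : DecaysAlong a F (fun x => x i) := by
  induction i using WellFoundedGT.induction with
  | ind i ih =>
    exact decaysAlong_apply_of_row (hcont i hi) (fun t ht => hβ t ht i hi)
      (fun t ht => hlow t ht i hi) (hdiag i hi) fun l hl => ih l hl (hS hl.le hi)

end DecaysAlong

/-! ### Exponential stability of the Kalman-Bucy observer -/

section RiccatiDecay

variable {k p : ℕ} {a p₁ p₂ g : ℝ} {B G P : ℝ → Matrix (Fin k) (Fin k) ℝ}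
  {D : ℝ → Matrix (Fin p) (Fin k) ℝ} {z h : ℝ → EuclideanSpace ℝ (Fin k)} {s t : ℝ}

theorem LoewnerBounds.posDef (hP : LoewnerBounds a p₁ p₂ P) (hp₁ : 0 < p₁) (ht : a ≤ t) :
    (P t).PosDef :=
  posDef_of_posSemidef_sub_smul_one hp₁ (hP t ht).1

theorem LoewnerBounds.norm_le (hP : LoewnerBounds a p₁ p₂ P) (hp₁ : 0 < p₁) (hp₂ : 0 < p₂)
    (ht : a ≤ t) : ‖P t‖ ≤ p₂ :=
  norm_le_of_posDef (hP.posDef hp₁ ht) hp₂ (hP t ht).2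

theorem IsRiccatiSolution.hasDerivWithinAt_inv_mulVecL (hP : IsRiccatiSolution a B D G P)
    (hs : a ≤ s) (ht : s ≤ t) (hPu : IsUnit (P t))
    (hz : HasDerivWithinAt z (mulVecL (B t - P t * (D t)ᵀ * D t) (z t) + h t) (Ici s) t) :
    HasDerivWithinAt (fun τ => mulVecL (P τ)⁻¹ (z τ))
      (mulVecL (P t)⁻¹ (h t - mulVecL (G t) (mulVecL (P t)⁻¹ (z t))) -
        mulVecL (B t)ᵀ (mulVecL (P t)⁻¹ (z t))) (Ici s) t := by
  have hPinv := hasDerivWithinAt_matrix_inv ((hP t (hs.trans ht)).mono (Ici_subset_Ici.2 hs)) hPu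
  refine (hasDerivWithinAt_mulVecL hPinv hz).congr_deriv ?_
  set y := mulVecL (P t)⁻¹ (z t)
  have hPy : z t = mulVecL (P t) y := (mulVecL_mulVecL_inv hPu _).symm
  simp only [hPy, map_add, map_sub, map_neg, _root_.add_apply, _root_.sub_apply,
    _root_.neg_apply, mulVecL_mul,
    mulVecL_inv_mulVecL hPu]
  abel

theorem IsRiccatiSolution.hasDerivWithinAt_inner_inv (hP : IsRiccatiSolution a B D G P)
    (hs : a ≤ s) (ht : s ≤ t) (hPd : (P t).PosDef)
    (hz : HasDerivWithinAt z (mulVecL (B t - P t * (D t)ᵀ * D t) (z t) + h t) (Ici s) t) :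
    HasDerivWithinAt (fun τ => inner ℝ (z τ) (mulVecL (P τ)⁻¹ (z τ)))
      (2 * inner ℝ (mulVecL (P t)⁻¹ (z t)) (h t) - ‖mulVecL (D t) (z t)‖ ^ 2 -
        inner ℝ (mulVecL (P t)⁻¹ (z t)) (mulVecL (G t) (mulVecL (P t)⁻¹ (z t)))) (Ici s) t := by
  refine (hz.inner ℝ (hP.hasDerivWithinAt_inv_mulVecL hs ht hPd.isUnit hz)).congr_deriv ?_
  have hPsymm : (P t)ᵀ = P t := hPd.isHermitian
  have hPinv_symm : ((P t)⁻¹)ᵀ = (P t)⁻¹ := by rw [transpose_nonsing_inv, hPsymm]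
  set y := mulVecL (P t)⁻¹ (z t)
  have hPy : mulVecL (P t) y = z t := mulVecL_mulVecL_inv hPd.isUnit _
  have hDz : inner ℝ (mulVecL (P t * (D t)ᵀ * D t) (z t)) y = ‖mulVecL (D t) (z t)‖ ^ 2 := by
    rw [mulVecL_mul, mulVecL_mul, inner_mulVecL_left, hPsymm, hPy, inner_mulVecL_left,
      transpose_transpose, real_inner_self_eq_norm_sq]
  have hPinv : ∀ x, inner ℝ (z t) (mulVecL (P t)⁻¹ x) = inner ℝ y x := fun x => by
    rw [inner_mulVecL_right, hPinv_symm]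
  rw [inner_sub_right, hPinv, ← inner_mulVecL_left (B t), inner_sub_right, map_sub,
    _root_.sub_apply, inner_add_left, inner_sub_left, hDz, real_inner_comm y (h t)]
  ring

theorem two_mul_inner_le_add {E : Type*} [NormedAddCommGroup E] [InnerProductSpace ℝ E] {c : ℝ}
    (hc : 0 < c) (x y : E) : 2 * inner ℝ x y ≤ c * ‖x‖ ^ 2 + c⁻¹ * ‖y‖ ^ 2 := by
  have hsq : c * ‖x‖ ^ 2 + c⁻¹ * ‖y‖ ^ 2 - 2 * (‖x‖ * ‖y‖) = c⁻¹ * (c * ‖x‖ - ‖y‖) ^ 2 := by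
    field_simp
    ring
  have hnonneg : 0 ≤ c⁻¹ * (c * ‖x‖ - ‖y‖) ^ 2 := by positivity
  linarith [real_inner_le_norm x y]

theorem lyapunov_rate_le {P G : Matrix (Fin k) (Fin k) ℝ} {D : Matrix (Fin p) (Fin k) ℝ}
    (hPd : P.PosDef) (hp₂ : 0 < p₂) (hg : 0 < g)
    (hPp₂ : (p₂ • (1 : Matrix (Fin k) (Fin k) ℝ) - P).PosSemidef)
    (hG : (G - g • (1 : Matrix (Fin k) (Fin k) ℝ)).PosSemidef) (z h : EuclideanSpace ℝ (Fin k)) :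
    2 * inner ℝ (mulVecL P⁻¹ z) h - ‖mulVecL D z‖ ^ 2 -
        inner ℝ (mulVecL P⁻¹ z) (mulVecL G (mulVecL P⁻¹ z)) ≤
      -(g / (2 * p₂)) * inner ℝ z (mulVecL P⁻¹ z) + 2 / g * ‖h‖ ^ 2 := by
  set y := mulVecL P⁻¹ z
  have hPy : mulVecL P y = z := mulVecL_mulVecL_inv hPd.isUnit _
  have hyz : g / (2 * p₂) * inner ℝ z y ≤ g / 2 * ‖y‖ ^ 2 := calc
    g / (2 * p₂) * inner ℝ z y ≤ g / (2 * p₂) * (p₂ * ‖y‖ ^ 2) := by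
      gcongr
      rw [real_inner_comm, ← hPy]
      exact (posSemidef_smul_one_sub_iff.1 hPp₂).2 y
    _ = g / 2 * ‖y‖ ^ 2 := by field_simp
  have hyG : g * ‖y‖ ^ 2 ≤ inner ℝ y (mulVecL G y) := (posSemidef_sub_smul_one_iff.1 hG).2 y
  have hyh := two_mul_inner_le_add (half_pos hg) y h
  rw [inv_div] at hyh
  linarith [sq_nonneg ‖mulVecL D z‖]

theorem IsRiccatiSolution.inner_inv_le_exp (hP : IsRiccatiSolution a B D G P)
    (hp₁ : 0 < p₁) (hp₂ : 0 < p₂) (hg : 0 < g) (hPb : LoewnerBounds a p₁ p₂ P)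
    (hG : ∀ t, a ≤ t → (G t - g • (1 : Matrix (Fin k) (Fin k) ℝ)).PosSemidef)
    {M γ : ℝ} (hγ : γ < g / (2 * p₂)) (hM : 0 ≤ M) (hs : a ≤ s) (ht : s ≤ t)
    (hz : ∀ t, s ≤ t →
      HasDerivWithinAt z (mulVecL (B t - P t * (D t)ᵀ * D t) (z t) + h t) (Ici s) t)
    (hh : ∀ t, s ≤ t → 2 / g * ‖h t‖ ^ 2 ≤ M * Real.exp (-γ * (t - s))) :
    inner ℝ (z t) (mulVecL (P t)⁻¹ (z t)) ≤
      (p₁⁻¹ * ‖z s‖ ^ 2 + M / (g / (2 * p₂) - γ)) * Real.exp (-γ * (t - s)) := by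
  have hV := le_exp_of_deriv_le_mul_add_exp (b := fun _ => -(g / (2 * p₂))) (K := 0)
    continuousOn_const ht hγ hM (fun τ _ _ => le_of_eq (by simp; ring))
    (fun τ hτ => hP.hasDerivWithinAt_inner_inv hs hτ (hPb.posDef hp₁ (hs.trans hτ)) (hz τ hτ))
    fun τ hτ => (lyapunov_rate_le (hPb.posDef hp₁ (hs.trans hτ)) hp₂ hg (hPb τ (hs.trans hτ)).2
      (hG τ (hs.trans hτ)) (z τ) (h τ)).trans (by linarith [hh τ hτ])
  have hinit : |inner ℝ (z s) (mulVecL (P s)⁻¹ (z s))| ≤ p₁⁻¹ * ‖z s‖ ^ 2 := by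
    rw [abs_of_nonneg ((posSemidef_iff_inner.1 (hPb.posDef hp₁ hs).inv.posSemidef).2 _)]
    exact (posSemidef_smul_one_sub_iff.1 (inv_le_inv_smul_one hp₁ (hPb s hs).1)).2 (z s)
  rw [Real.exp_zero, one_mul] at hV
  refine hV.trans ?_
  gcongr

theorem IsRiccatiSolution.exists_decay (hP : IsRiccatiSolution a B D G P)
    (hp₁ : 0 < p₁) (hp₂ : 0 < p₂) (hg : 0 < g) (hPb : LoewnerBounds a p₁ p₂ P)
    (hG : ∀ t, a ≤ t → (G t - g • (1 : Matrix (Fin k) (Fin k) ℝ)).PosSemidef)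
    {μ κ : ℝ} (hμ : 0 < μ) :
    ∃ ν K : ℝ, 0 < ν ∧ 0 ≤ K ∧ ∀ s, a ≤ s → ∀ (z h : ℝ → EuclideanSpace ℝ (Fin k)) (N : ℝ),
      ‖z s‖ ≤ N →
      (∀ t, s ≤ t →
        HasDerivWithinAt z (mulVecL (B t - P t * (D t)ᵀ * D t) (z t) + h t) (Ici s) t) →
      (∀ t, s ≤ t → ‖h t‖ ≤ κ * Real.exp (-μ * (t - s)) * N) →
      ∀ t, s ≤ t → ‖z t‖ ≤ K * Real.exp (-ν * (t - s)) * N := by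
  set α := g / (2 * p₂)
  have hα : 0 < α := by positivity
  set ν := min μ (α / 4)
  have hν : 2 * ν < α := by linarith [min_le_right μ (α / 4)]
  have : 0 < α - 2 * ν := sub_pos.2 hν
  refine ⟨ν, √(p₂ * (p₁⁻¹ + 2 / g * κ ^ 2 / (α - 2 * ν))), lt_min hμ (by positivity),
    Real.sqrt_nonneg _, fun s hs z h N hzs hz hh t ht => ?_⟩
  have hN : 0 ≤ N := (norm_nonneg _).trans hzs
  have hforce : ∀ t, s ≤ t →
      2 / g * ‖h t‖ ^ 2 ≤ 2 / g * κ ^ 2 * N ^ 2 * Real.exp (-(2 * ν) * (t - s)) := fun t ht => calc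
    _ ≤ 2 / g * (κ * Real.exp (-μ * (t - s)) * N) ^ 2 := by gcongr; exact hh t ht
    _ = 2 / g * κ ^ 2 * N ^ 2 * Real.exp (-(2 * μ) * (t - s)) := by
      rw [mul_pow, mul_pow, ← Real.exp_nat_mul]; push_cast; ring_nf
    _ ≤ _ := by gcongr; exact min_le_left _ _
  have hV := hP.inner_inv_le_exp hp₁ hp₂ hg hPb hG hν (by positivity) hs ht hz hforce
  have hform : p₂⁻¹ * ‖z t‖ ^ 2 ≤ inner ℝ (z t) (mulVecL (P t)⁻¹ (z t)) :=
    (posSemidef_sub_smul_one_iff.1 (inv_smul_one_le_inv (hPb.posDef hp₁ (hs.trans ht)) hp₂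
      (hPb t (hs.trans ht)).2)).2 (z t)
  refine le_of_sq_le_sq ?_ (by positivity)
  calc ‖z t‖ ^ 2 ≤ p₂ * ((p₁⁻¹ * ‖z s‖ ^ 2 + 2 / g * κ ^ 2 * N ^ 2 / (α - 2 * ν)) *
        Real.exp (-(2 * ν) * (t - s))) := (inv_mul_le_iff₀ hp₂).1 (hform.trans hV)
    _ ≤ p₂ * ((p₁⁻¹ * N ^ 2 + 2 / g * κ ^ 2 * N ^ 2 / (α - 2 * ν)) *
        Real.exp (-(2 * ν) * (t - s))) := by gcongr
    _ = (√(p₂ * (p₁⁻¹ + 2 / g * κ ^ 2 / (α - 2 * ν))) * Real.exp (-ν * (t - s)) * N) ^ 2 := by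
      rw [mul_pow, mul_pow, Real.sq_sqrt (by positivity), ← Real.exp_nat_mul]
      push_cast
      ring_nf

end RiccatiDecay

/-! ### The orthogonal frame of the QR decomposition -/

section Isometry

variable {m n : Type*} [Fintype m] [Fintype n] [DecidableEq n]

theorem abs_apply_le_l2_opNorm (M : Matrix m n ℝ) (i : m) (l : n) : |M i l| ≤ ‖M‖ := by
  have hentry : mulVecL M (EuclideanSpace.single l 1) i = M i l := by simp [mulVecL_apply]
  calc |M i l| ≤ ‖mulVecL M (EuclideanSpace.single l 1)‖ :=
        hentry ▸ PiLp.norm_apply_le (mulVecL M (EuclideanSpace.single l 1)) i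
    _ ≤ ‖M‖ := (norm_mulVecL_le M _).trans_eq (by rw [PiLp.norm_single, norm_one, mul_one])

theorem norm_mulVecL_of_transpose_mul_self {M : Matrix m n ℝ} (h : Mᵀ * M = 1)
    (x : EuclideanSpace ℝ n) : ‖mulVecL M x‖ = ‖x‖ := by
  rw [← sq_eq_sq₀ (norm_nonneg _) (norm_nonneg _), ← inner_mulVecL_transpose_mul_self, h,
    mulVecL_one, real_inner_self_eq_norm_sq]

theorem l2_opNorm_le_one_of_transpose_mul_self {M : Matrix m n ℝ} (h : Mᵀ * M = 1) : ‖M‖ ≤ 1 :=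
  l2_opNorm_le_of_norm_mulVecL_le zero_le_one fun x => by
    rw [norm_mulVecL_of_transpose_mul_self h, one_mul]

theorem norm_mul_le_of_transpose_mul_self {l : Type*} [Fintype l] [DecidableEq m]
    {M : Matrix l m ℝ} {J : Matrix m n ℝ} (hJ : Jᵀ * J = 1) : ‖M * J‖ ≤ ‖M‖ :=
  (l2_opNorm_mul _ _).trans
    (mul_le_of_le_one_right (norm_nonneg _) (l2_opNorm_le_one_of_transpose_mul_self hJ))

end Isometry

section TransformedMatrix

variable {n k : ℕ}

theorem skewMatrix_transpose (A : Matrix (Fin n) (Fin n) ℝ) (Q : Matrix (Fin n) (Fin k) ℝ) :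
    (skewMatrix A Q)ᵀ = -skewMatrix A Q := by
  ext i l
  simp only [skewMatrix, transpose_apply, Matrix.neg_apply, of_apply]
  rcases lt_trichotomy i l with h | h | h
  · simp [h, h.not_gt]
  · simp [h]
  · simp [h, h.not_gt]

theorem transformedMatrix_apply_of_lt (A : Matrix (Fin n) (Fin n) ℝ) (Q : Matrix (Fin n) (Fin k) ℝ)
    {i l : Fin k} (h : l < i) : transformedMatrix A Q i l = 0 := by
  simp [transformedMatrix, skewMatrix, h]

theorem transformedMatrix_apply_self (A : Matrix (Fin n) (Fin n) ℝ) (Q : Matrix (Fin n) (Fin k) ℝ)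
    (i : Fin k) : transformedMatrix A Q i i = (Qᵀ * A * Q) i i := by
  simp [transformedMatrix, skewMatrix]

/-- The upper triangular matrix `M - S`, where the skew-symmetric `S` agrees with `M` below the
diagonal. It exhibits `transformedMatrix A Q = upperFold k (Qᵀ * A * Q)` as a linear function
of `Qᵀ * A * Q`. -/
def upperFold (k : ℕ) : Matrix (Fin k) (Fin k) ℝ →ₗ[ℝ] Matrix (Fin k) (Fin k) ℝ where
  toFun M := M - of fun i l => if l < i then M i l else if i < l then -M l i else 0
  map_add' M N := by
    ext i l
    simp only [Matrix.sub_apply, Matrix.add_apply, of_apply]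
    split_ifs <;> ring
  map_smul' c M := by
    ext i l
    simp only [Matrix.sub_apply, Matrix.smul_apply, of_apply, smul_eq_mul, RingHom.id_apply]
    split_ifs <;> ring

theorem exists_norm_transformedMatrix_le (n k : ℕ) : ∃ c : ℝ, 0 ≤ c ∧
    ∀ (A : Matrix (Fin n) (Fin n) ℝ) (Q : Matrix (Fin n) (Fin k) ℝ), Qᵀ * Q = 1 →
      ‖transformedMatrix A Q‖ ≤ c * ‖A‖ := by
  obtain ⟨c, hc, hbound⟩ := (upperFold k).toContinuousLinearMap.bound
  refine ⟨c, hc.le, fun A Q hQ => (hbound (Qᵀ * A * Q)).trans ?_⟩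
  have hQ_norm := l2_opNorm_le_one_of_transpose_mul_self hQ
  gcongr
  calc ‖Qᵀ * A * Q‖ ≤ ‖Qᵀ‖ * ‖A‖ * ‖Q‖ :=
        (l2_opNorm_mul _ _).trans (by gcongr; exact l2_opNorm_mul _ _)
    _ ≤ 1 * ‖A‖ * 1 := by rw [l2_opNorm_transpose]; gcongr
    _ = ‖A‖ := by ring

@[fun_prop]
theorem continuousOn_transformedMatrix {A : ℝ → Matrix (Fin n) (Fin n) ℝ}
    {Q : ℝ → Matrix (Fin n) (Fin k) ℝ} {s : Set ℝ} (hA : ContinuousOn A s)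
    (hQ : ContinuousOn Q s) : ContinuousOn (fun t => transformedMatrix (A t) (Q t)) s :=
  (upperFold k).toContinuousLinearMap.continuous.comp_continuousOn (by fun_prop)

end TransformedMatrix

section LeadingColumns

variable {n k : ℕ} (h : k ≤ n)

/-- The first `k` columns of the identity matrix: the embedding of `ℝᵏ` as the leading coordinates
of `ℝⁿ`. -/
def columnInclusion : Matrix (Fin n) (Fin k) ℝ :=
  leadingColumns h 1

theorem leadingColumns_eq_mul (Q : Matrix (Fin n) (Fin n) ℝ) :
    leadingColumns h Q = Q * columnInclusion h := by
  ext i l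
  simp [leadingColumns, columnInclusion, mul_apply, one_apply]

theorem columnInclusion_transpose_mul_self : (columnInclusion h)ᵀ * columnInclusion h = 1 := by
  ext i l
  simp [leadingColumns, columnInclusion, mul_apply, one_apply, eq_comm]

theorem columnInclusion_apply_of_le {i : Fin n} (hi : k ≤ i) (l : Fin k) :
    columnInclusion h i l = 0 :=
  one_apply_ne fun hil => (l.isLt.trans_le hi).ne' (congrArg Fin.val hil)

theorem sub_mulVecL_columnInclusion_eq_sum (x : EuclideanSpace ℝ (Fin n)) :
    x - mulVecL (columnInclusion h) (mulVecL (columnInclusion h)ᵀ x) =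
      ∑ i with k ≤ (i : Fin n).val, EuclideanSpace.single i (x i) := by
  ext i
  rw [PiLp.sub_apply, WithLp.ofLp_sum, Finset.sum_apply]
  rcases le_or_gt k i with hi | hi
  · simp [mulVecL_apply, columnInclusion_apply_of_le h hi, hi]
  · obtain ⟨l, rfl⟩ : ∃ l : Fin k, Fin.castLE h l = i := ⟨⟨i, hi⟩, rfl⟩
    simp [mulVecL_apply, columnInclusion, leadingColumns, one_apply]

theorem transformedMatrix_leadingColumns (A Q : Matrix (Fin n) (Fin n) ℝ) :
    transformedMatrix A (leadingColumns h Q) =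
      (columnInclusion h)ᵀ * transformedMatrix A Q * columnInclusion h := by
  have hsub : ∀ M : Matrix (Fin n) (Fin n) ℝ, (columnInclusion h)ᵀ * M * columnInclusion h =
      M.submatrix (Fin.castLE h) (Fin.castLE h) := fun M => by
    ext i l
    simp [columnInclusion, leadingColumns, mul_apply, one_apply]
  have hconj : (leadingColumns h Q)ᵀ * A * leadingColumns h Q =
      (Qᵀ * A * Q).submatrix (Fin.castLE h) (Fin.castLE h) := by
    rw [← hsub, leadingColumns_eq_mul, transpose_mul]
    simp only [Matrix.mul_assoc]
  rw [hsub]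
  ext i l
  simp [transformedMatrix, skewMatrix, hconj]

end LeadingColumns

section Frame

variable {n k : ℕ} {A Q : ℝ → Matrix (Fin n) (Fin n) ℝ}

/-- `Q` is a moving orthonormal frame of continuous QR type for `ẋ = A(t) x`: an orthogonal solution
of `Q̇ = Q S(A, Q)`. In the coordinates `Qᵀ x` the system is upper triangular. -/
structure IsQRFrame (A Q : ℝ → Matrix (Fin n) (Fin n) ℝ) : Prop where
  ode : ∀ t, 0 ≤ t → HasDerivWithinAt Q (Q t * skewMatrix (A t) (Q t)) (Ici 0) t
  transpose_mul_self : ∀ t, 0 ≤ t → (Q t)ᵀ * Q t = 1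

theorem isQRFrame_of_ode {t₀ : ℝ} (ht₀ : 0 ≤ t₀)
    (hode : ∀ t, 0 ≤ t → HasDerivWithinAt Q (Q t * skewMatrix (A t) (Q t)) (Ici 0) t)
    (hinit : (Q t₀)ᵀ * Q t₀ = 1) : IsQRFrame A Q := by
  have hd : ∀ t, 0 ≤ t → HasDerivWithinAt (fun τ => Q τ * (Q τ)ᵀ) 0 (Ici 0) t := fun t ht => by
    refine (hasDerivWithinAt_matrix_mul (hode t ht)
      (hasDerivWithinAt_matrix_transpose (hode t ht))).congr_deriv ?_
    rw [transpose_mul, skewMatrix_transpose]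
    noncomm_ring
  have hconst : ∀ t, 0 ≤ t → Q t * (Q t)ᵀ = Q 0 * (Q 0)ᵀ := fun t ht =>
    eq_of_hasDerivWithinAt_zero (f := fun τ => Q τ * (Q τ)ᵀ) hd ht
  exact ⟨hode, fun t ht => mul_eq_one_comm.1 <| by
    rw [hconst t ht, ← hconst t₀ ht₀, mul_eq_one_comm.1 hinit]⟩

namespace IsQRFrame

theorem mul_transpose_self (hQ : IsQRFrame A Q) {t : ℝ} (ht : 0 ≤ t) : Q t * (Q t)ᵀ = 1 :=
  mul_eq_one_comm.1 (hQ.transpose_mul_self t ht)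

@[fun_prop]
theorem continuousOn (hQ : IsQRFrame A Q) : ContinuousOn Q (Ici 0) :=
  fun t ht => (hQ.ode t ht).continuousWithinAt

theorem leadingColumns_transpose_mul_self (hQ : IsQRFrame A Q) (h : k ≤ n) {t : ℝ} (ht : 0 ≤ t) :
    (leadingColumns h (Q t))ᵀ * leadingColumns h (Q t) = 1 := by
  rw [leadingColumns_eq_mul, transpose_mul, Matrix.mul_assoc, ← Matrix.mul_assoc _ (Q t),
    hQ.transpose_mul_self t ht, Matrix.one_mul, columnInclusion_transpose_mul_self]

theorem continuousOn_leadingColumns (hQ : IsQRFrame A Q) (h : k ≤ n) :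
    ContinuousOn (fun t => leadingColumns h (Q t)) (Ici 0) := by
  simp only [leadingColumns_eq_mul]
  exact continuousOn_matrix_mul hQ.continuousOn continuousOn_const

theorem isSolutionFrom_transpose_mulVecL (hQ : IsQRFrame A Q) {M : ℝ → Matrix (Fin n) (Fin n) ℝ}
    {s : ℝ} (hs : 0 ≤ s) {e : ℝ → EuclideanSpace ℝ (Fin n)}
    (he : IsSolutionFrom (fun t => A t - M t) s e) :
    IsSolutionFrom (fun t => transformedMatrix (A t) (Q t) - (Q t)ᵀ * M t * Q t) s
      (fun t => mulVecL (Q t)ᵀ (e t)) := fun t ht => by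
  have ht₀ := hs.trans ht
  refine (hasDerivWithinAt_mulVecL (hasDerivWithinAt_matrix_transpose
    ((hQ.ode t ht₀).mono (Ici_subset_Ici.2 hs))) (he t ht)).congr_deriv ?_
  change mulVecL (Q t)ᵀ (mulVecL (A t - M t) (e t)) + _ = mulVecL _ (mulVecL (Q t)ᵀ (e t))
  simp only [← mulVecL_mul, ← _root_.add_apply, ← map_add]
  congr 2
  rw [transpose_mul, skewMatrix_transpose, transformedMatrix, Matrix.sub_mul, Matrix.sub_mul,
    Matrix.mul_assoc _ (Q t), Matrix.mul_assoc _ (Q t), hQ.mul_transpose_self ht₀]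
  noncomm_ring

theorem isUniformlyExponentiallyStable (hQ : IsQRFrame A Q) {M : ℝ → Matrix (Fin n) (Fin n) ℝ}
    {a : ℝ} (ha : 0 ≤ a) (h : IsUniformlyExponentiallyStable a
      (fun t => transformedMatrix (A t) (Q t) - (Q t)ᵀ * M t * Q t)) :
    IsUniformlyExponentiallyStable a (fun t => A t - M t) := by
  obtain ⟨μ, K, hμ, hK, h⟩ := h
  have hnorm : ∀ t, 0 ≤ t → ∀ x, ‖mulVecL (Q t)ᵀ x‖ = ‖x‖ := fun t ht =>
    norm_mulVecL_of_transpose_mul_self (by rw [transpose_transpose, hQ.mul_transpose_self ht])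
  refine ⟨μ, K, hμ, hK, fun s hs e he t ht => ?_⟩
  have hs₀ := ha.trans hs
  simpa only [hnorm t (hs₀.trans ht), hnorm s hs₀] using
    h s hs _ (hQ.isSolutionFrom_transpose_mulVecL hs₀ he) t ht

end IsQRFrame

end Frame

/-! ### Observers that correct only the leading coordinates -/

section BlockObserver

variable {n k p : ℕ} {a : ℝ} {F : ℝ → Matrix (Fin n) (Fin n) ℝ}

theorem decaysAlong_sub_mulVecL_columnInclusion (h : k ≤ n)
    (htail : ∀ i : Fin n, k ≤ i → DecaysAlong a F (fun x => x i)) :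
    DecaysAlong a F
      (fun x => x - mulVecL (columnInclusion h) (mulVecL (columnInclusion h)ᵀ x)) := by
  have hsum : DecaysAlong a F
      (∑ i with k ≤ (i : Fin n).val, fun x => EuclideanSpace.single i (x i)) :=
    DecaysAlong.sum fun i hi => (htail i (Finset.mem_filter.1 hi).2).of_norm_le fun x => by
      rw [PiLp.norm_single]
  exact hsum.of_norm_le fun x => by rw [sub_mulVecL_columnInclusion_eq_sum, Finset.sum_apply]

variable {g p₁ p₂ : ℝ} {B : ℝ → Matrix (Fin n) (Fin n) ℝ} {E : ℝ → Matrix (Fin p) (Fin n) ℝ}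
  {G P : ℝ → Matrix (Fin k) (Fin k) ℝ}

theorem IsSolutionFrom.hasDerivWithinAt_transpose_mulVecL {J : Matrix (Fin n) (Fin k) ℝ} {s : ℝ}
    {x : ℝ → EuclideanSpace ℝ (Fin n)} (hx : IsSolutionFrom F s x) {t : ℝ} (ht : s ≤ t) :
    HasDerivWithinAt (fun τ => mulVecL Jᵀ (x τ))
      (mulVecL (Jᵀ * F t * J) (mulVecL Jᵀ (x t)) +
        mulVecL (Jᵀ * F t) (x t - mulVecL J (mulVecL Jᵀ (x t)))) (Ici s) t := by
  refine ((mulVecL Jᵀ).hasFDerivAt.comp_hasDerivWithinAt t (hx t ht)).congr_deriv ?_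
  change mulVecL Jᵀ (mulVecL (F t) (x t)) = _
  simp only [map_sub, mulVecL_mul]
  abel

theorem IsRiccatiSolution.decaysAlong_transpose_mulVecL {J : Matrix (Fin n) (Fin k) ℝ}
    (hJ : Jᵀ * J = 1) (hP : IsRiccatiSolution a (fun t => Jᵀ * B t * J) (fun t => E t * J) G P)
    (hp₁ : 0 < p₁) (hp₂ : 0 < p₂) (hg : 0 < g) (hPb : LoewnerBounds a p₁ p₂ P)
    (hG : ∀ t, a ≤ t → (G t - g • (1 : Matrix (Fin k) (Fin k) ℝ)).PosSemidef)
    (hF : ∀ t, a ≤ t → F t = B t - J * P t * (E t * J)ᵀ * E t)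
    {φ : ℝ} (hφ : ∀ t, a ≤ t → ‖F t‖ ≤ φ)
    (hrem : DecaysAlong a F (fun x => x - mulVecL J (mulVecL Jᵀ x))) :
    DecaysAlong a F (mulVecL Jᵀ) := by
  obtain ⟨μ, K, hμ, _, hrem⟩ := hrem
  obtain ⟨ν, L, hν, hL, hdecay⟩ := hP.exists_decay (κ := φ * K) hp₁ hp₂ hg hPb hG hμ
  have hJ_norm : ‖Jᵀ‖ ≤ 1 := l2_opNorm_transpose J ▸ l2_opNorm_le_one_of_transpose_mul_self hJ
  have hφ₀ : 0 ≤ φ := (norm_nonneg _).trans (hφ a le_rfl)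
  have hblock : ∀ t, a ≤ t → Jᵀ * F t * J = Jᵀ * B t * J - P t * (E t * J)ᵀ * (E t * J) :=
    fun t ht => by
      rw [hF t ht, Matrix.mul_sub, Matrix.sub_mul]
      simp only [← Matrix.mul_assoc, hJ, Matrix.one_mul]
  refine ⟨ν, L, hν, hL, fun s hs x hx => hdecay s hs (fun t => mulVecL Jᵀ (x t))
    (fun t => mulVecL (Jᵀ * F t) (x t - mulVecL J (mulVecL Jᵀ (x t)))) ‖x s‖ ?_ (fun t ht => ?_)
    fun t ht => ?_⟩
  · exact (norm_mulVecL_le _ _).trans (mul_le_of_le_one_left (norm_nonneg _) hJ_norm)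
  · exact hblock t (hs.trans ht) ▸ hx.hasDerivWithinAt_transpose_mulVecL ht
  · calc _ ≤ ‖Jᵀ * F t‖ * ‖x t - mulVecL J (mulVecL Jᵀ (x t))‖ := norm_mulVecL_le _ _
      _ ≤ (1 * φ) * (K * Real.exp (-μ * (t - s)) * ‖x s‖) := by
        gcongr
        · exact (l2_opNorm_mul _ _).trans (by gcongr; exact hφ t (hs.trans ht))
        · exact hrem s hs x hx t ht
      _ = _ := by ring

theorem IsRiccatiSolution.isUniformlyExponentiallyStable_of_tail (h : k ≤ n)
    (hP : IsRiccatiSolution a (fun t => (columnInclusion h)ᵀ * B t * columnInclusion h)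
      (fun t => E t * columnInclusion h) G P)
    (hp₁ : 0 < p₁) (hp₂ : 0 < p₂) (hg : 0 < g) (hPb : LoewnerBounds a p₁ p₂ P)
    (hG : ∀ t, a ≤ t → (G t - g • (1 : Matrix (Fin k) (Fin k) ℝ)).PosSemidef)
    (hF : ∀ t, a ≤ t →
      F t = B t - columnInclusion h * P t * (E t * columnInclusion h)ᵀ * E t)
    {φ : ℝ} (hφ : ∀ t, a ≤ t → ‖F t‖ ≤ φ)
    (htail : ∀ i : Fin n, k ≤ i → DecaysAlong a F (fun x => x i)) :
    IsUniformlyExponentiallyStable a F := by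
  have hJ := columnInclusion_transpose_mul_self h
  have hrem := decaysAlong_sub_mulVecL_columnInclusion h htail
  have hlead := hP.decaysAlong_transpose_mulVecL hJ hp₁ hp₂ hg hPb hG hF hφ hrem
  have hlead' : DecaysAlong a F
      (fun x => mulVecL (columnInclusion h) (mulVecL (columnInclusion h)ᵀ x)) :=
    hlead.of_norm_le fun x => (norm_mulVecL_of_transpose_mul_self hJ _).le
  exact ((hlead'.add hrem).of_norm_le fun x =>
    le_of_eq (by simp)).isUniformlyExponentiallyStable

theorem norm_blockObserver_le {B : Matrix (Fin n) (Fin n) ℝ} {E : Matrix (Fin p) (Fin n) ℝ}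
    {P : Matrix (Fin k) (Fin k) ℝ} {J : Matrix (Fin n) (Fin k) ℝ} {β δ : ℝ} (hJ : Jᵀ * J = 1)
    (hB : ‖B‖ ≤ β) (hE : ‖E‖ ≤ δ) (hP : ‖P‖ ≤ p₂) :
    ‖B - J * P * (E * J)ᵀ * E‖ ≤ β + p₂ * δ ^ 2 := by
  have hJ_norm := l2_opNorm_le_one_of_transpose_mul_self hJ
  have hδ : 0 ≤ δ := (norm_nonneg _).trans hE
  have hp₂ : 0 ≤ p₂ := (norm_nonneg _).trans hP
  have hEJ : ‖E * J‖ ≤ δ := (norm_mul_le_of_transpose_mul_self hJ).trans hE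
  have hJP : ‖J * P‖ ≤ 1 * p₂ := (l2_opNorm_mul _ _).trans (by gcongr)
  calc _ ≤ ‖B‖ + ‖J * P‖ * ‖(E * J)ᵀ‖ * ‖E‖ := (norm_sub_le _ _).trans <| by
        gcongr
        exact (l2_opNorm_mul _ _).trans (by gcongr; exact l2_opNorm_mul _ _)
    _ ≤ β + 1 * p₂ * δ * δ := by rw [l2_opNorm_transpose]; gcongr
    _ = _ := by ring

theorem IsRiccatiSolution.isUniformlyExponentiallyStable_of_upperTriangular (h : k ≤ n)
    (hP : IsRiccatiSolution a (fun t => (columnInclusion h)ᵀ * B t * columnInclusion h)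
      (fun t => E t * columnInclusion h) G P)
    (hp₁ : 0 < p₁) (hp₂ : 0 < p₂) (hg : 0 < g) (hPb : LoewnerBounds a p₁ p₂ P)
    (hG : ∀ t, a ≤ t → (G t - g • (1 : Matrix (Fin k) (Fin k) ℝ)).PosSemidef)
    {β δ : ℝ} (hB : ContinuousOn B (Ici a)) (hβ : ∀ t, a ≤ t → ‖B t‖ ≤ β)
    (hδ : ∀ t, a ≤ t → ‖E t‖ ≤ δ)
    (hlow : ∀ t, a ≤ t → ∀ i : Fin n, k ≤ i → ∀ l < i, B t i l = 0)
    (hdiag : ∀ i : Fin n, k ≤ i → ∃ c K : ℝ, 0 < c ∧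
      ∀ s t, a ≤ s → s ≤ t → ∫ τ in s..t, B τ i i ≤ K - c * (t - s)) :
    IsUniformlyExponentiallyStable a
      (fun t => B t - columnInclusion h * P t * (E t * columnInclusion h)ᵀ * E t) := by
  refine hP.isUniformlyExponentiallyStable_of_tail h hp₁ hp₂ hg hPb hG (fun t _ => rfl)
    (fun t ht => norm_blockObserver_le (columnInclusion_transpose_mul_self h) (hβ t ht) (hδ t ht)
      (hPb.norm_le hp₁ hp₂ ht)) fun i hi => ?_
  have hrow : ∀ i : Fin n, k ≤ i → ∀ t l, (B t - columnInclusion h * P t *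
      (E t * columnInclusion h)ᵀ * E t) i l = B t i l := fun i hi t l => by
    rw [Matrix.sub_apply, Matrix.mul_assoc, Matrix.mul_assoc, mul_apply, sub_eq_self]
    exact Finset.sum_eq_zero fun m _ => by rw [columnInclusion_apply_of_le h hi, zero_mul]
  refine decaysAlong_apply_of_upperTriangular (β := β) (S := {i | k ≤ i.val})
    (fun _ _ hil hi => le_trans (b := Fin.val _) hi hil) ?_ ?_ ?_ ?_ hi
  · intro i hi
    simp only [hrow i hi]
    exact (continuous_apply_apply i i).comp_continuousOn hB
  · intro t ht i hi l
    rw [hrow i hi]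
    exact (abs_apply_le_l2_opNorm _ i l).trans (hβ t ht)
  · intro t ht i hi l hl
    rw [hrow i hi, hlow t ht i hi l hl]
  · intro i hi
    simpa only [hrow i hi] using hdiag i hi

end BlockObserver

/-! ### The observer gain `L = Q̄ P₁ Q̄ᵀ Cᵀ` -/

section ObserverGain

variable {n k p : ℕ} {a MA MC g p₁ p₂ : ℝ} {A Q : ℝ → Matrix (Fin n) (Fin n) ℝ}
  {C : ℝ → Matrix (Fin p) (Fin n) ℝ} {G P : ℝ → Matrix (Fin k) (Fin k) ℝ}

theorem IsQRFrame.exists_integral_transformedMatrix_le (hQ : IsQRFrame A Q)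
    (hA : ContinuousOn A (Ici 0)) (hMA : ∀ t, 0 ≤ t → ‖A t‖ ≤ MA) {i : Fin n}
    (hi : upperBohlExponent (fun t => ((Q t)ᵀ * A t * Q t) i i) < 0) :
    ∃ c K : ℝ, 0 < c ∧ ∀ s t, 0 ≤ s → s ≤ t →
      ∫ τ in s..t, transformedMatrix (A τ) (Q τ) i i ≤ K - c * (t - s) := by
  obtain ⟨c, hc, hbound⟩ := exists_norm_transformedMatrix_le n n
  refine exists_integral_le_of_upperBohlExponent_neg (M := c * MA)
    ((continuous_apply_apply i i).comp_continuousOn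
      (continuousOn_transformedMatrix hA hQ.continuousOn)) (fun t ht => ?_)
    (by simpa only [transformedMatrix_apply_self] using hi)
  calc transformedMatrix (A t) (Q t) i i ≤ ‖transformedMatrix (A t) (Q t)‖ :=
        (le_abs_self _).trans (abs_apply_le_l2_opNorm _ i i)
    _ ≤ c * ‖A t‖ := hbound _ _ (hQ.transpose_mul_self t ht)
    _ ≤ c * MA := by gcongr; exact hMA t ht

theorem IsUniformlyExponentiallyStable.congr {F F' : ℝ → Matrix (Fin n) (Fin n) ℝ}
    (hF : IsUniformlyExponentiallyStable a F) (h : ∀ t, a ≤ t → F' t = F t) :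
    IsUniformlyExponentiallyStable a F' :=
  hF.imp fun _ => Exists.imp fun _ ⟨hμ, hK, hdecay⟩ => ⟨hμ, hK, fun s hs x hx =>
    hdecay s hs x fun t ht => h t (hs.trans ht) ▸ hx t ht⟩

theorem transpose_mul_leadingColumns_gain_mul (h : k ≤ n) {Q : Matrix (Fin n) (Fin n) ℝ}
    (hQ : Qᵀ * Q = 1) (P : Matrix (Fin k) (Fin k) ℝ) (C : Matrix (Fin p) (Fin n) ℝ) :
    Qᵀ * (leadingColumns h Q * P * (leadingColumns h Q)ᵀ * Cᵀ * C) * Q =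
      columnInclusion h * P * (C * Q * columnInclusion h)ᵀ * (C * Q) := by
  simp only [leadingColumns_eq_mul, transpose_mul, ← Matrix.mul_assoc, hQ, Matrix.one_mul]

theorem IsQRFrame.isUniformlyExponentiallyStable_observer (hQ : IsQRFrame A Q)
    (hA : ContinuousOn A (Ici 0)) (hMA : ∀ t, 0 ≤ t → ‖A t‖ ≤ MA)
    (hMC : ∀ t, 0 ≤ t → ‖C t‖ ≤ MC) (hk : k ∈ stableTailIndices A Q) (ha : 0 ≤ a)
    (hP : IsRiccatiSolution a (fun t => transformedMatrix (A t) (leadingColumns hk.1 (Q t)))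
      (fun t => C t * leadingColumns hk.1 (Q t)) G P)
    (hp₁ : 0 < p₁) (hp₂ : 0 < p₂) (hg : 0 < g) (hPb : LoewnerBounds a p₁ p₂ P)
    (hG : ∀ t, a ≤ t → (G t - g • (1 : Matrix (Fin k) (Fin k) ℝ)).PosSemidef) :
    IsUniformlyExponentiallyStable a (fun t => A t - leadingColumns hk.1 (Q t) * P t *
      (leadingColumns hk.1 (Q t))ᵀ * (C t)ᵀ * C t) := by
  obtain ⟨c, hc, hbound⟩ := exists_norm_transformedMatrix_le n n
  have hB_norm : ∀ t, a ≤ t → ‖transformedMatrix (A t) (Q t)‖ ≤ c * MA := fun t ht =>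
    (hbound _ _ (hQ.transpose_mul_self t (ha.trans ht))).trans
      (by gcongr; exact hMA t (ha.trans ht))
  have hE_norm : ∀ t, a ≤ t → ‖C t * Q t‖ ≤ MC := fun t ht =>
    (norm_mul_le_of_transpose_mul_self (hQ.transpose_mul_self t (ha.trans ht))).trans
      (hMC t (ha.trans ht))
  have hP' : IsRiccatiSolution a
      (fun t => (columnInclusion hk.1)ᵀ * transformedMatrix (A t) (Q t) * columnInclusion hk.1)
      (fun t => C t * Q t * columnInclusion hk.1) G P := by
    simp only [transformedMatrix_leadingColumns] at hP
    simpa only [leadingColumns_eq_mul, ← Matrix.mul_assoc] using hP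
  have hstable := hP'.isUniformlyExponentiallyStable_of_upperTriangular hk.1 hp₁ hp₂ hg hPb hG
    ((continuousOn_transformedMatrix hA hQ.continuousOn).mono (Ici_subset_Ici.2 ha)) hB_norm
    hE_norm (fun t _ i _ l hl => transformedMatrix_apply_of_lt (A t) (Q t) hl)
    (fun i hi => (hQ.exists_integral_transformedMatrix_le hA hMA (hk.2 i hi)).imp
      fun _ ⟨K, hc, h⟩ => ⟨K, hc, fun s t hs => h s t (ha.trans hs)⟩)
  refine hQ.isUniformlyExponentiallyStable ha (hstable.congr fun t ht => ?_)
  rw [transpose_mul_leadingColumns_gain_mul hk.1 (hQ.transpose_mul_self t (ha.trans ht))]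

theorem IsQRFrame.exists_stableObserver (hQ : IsQRFrame A Q) (hA : ContinuousOn A (Ici 0))
    (hMA : ∀ t, 0 ≤ t → ‖A t‖ ≤ MA) (hC : ContinuousOn C (Ici 0))
    (hMC : ∀ t, 0 ≤ t → ‖C t‖ ≤ MC) (hk : k ∈ stableTailIndices A Q) (ha : 0 ≤ a)
    (hobs : IsUniformlyCompletelyObservable
      (fun t => transformedMatrix (A t) (leadingColumns hk.1 (Q t)))
      (fun t => C t * leadingColumns hk.1 (Q t)))
    (hGc : ContinuousOn G (Ici a)) {g₁ g₂ : ℝ} (hg₁ : 0 < g₁) (hg₂ : 0 < g₂)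
    (hG : LoewnerBounds a g₁ g₂ G) {P₀ : Matrix (Fin k) (Fin k) ℝ} (hP₀ : P₀.PosDef) :
    ∃ P, P a = P₀ ∧
      IsRiccatiSolution a (fun t => transformedMatrix (A t) (leadingColumns hk.1 (Q t)))
        (fun t => C t * leadingColumns hk.1 (Q t)) G P ∧
      (∃ p₁ p₂ : ℝ, 0 < p₁ ∧ 0 < p₂ ∧ LoewnerBounds a p₁ p₂ P) ∧
      IsUniformlyExponentiallyStable a (fun t => A t - leadingColumns hk.1 (Q t) * P t *
        (leadingColumns hk.1 (Q t))ᵀ * (C t)ᵀ * C t) := by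
  obtain ⟨c, hc, hbound⟩ := exists_norm_transformedMatrix_le n k
  have hQk := hQ.continuousOn_leadingColumns hk.1
  have hB_norm : ∀ t, 0 ≤ t →
      ‖transformedMatrix (A t) (leadingColumns hk.1 (Q t))‖ ≤ c * MA := fun t ht =>
    (hbound _ _ (hQ.leadingColumns_transpose_mul_self hk.1 ht)).trans (by gcongr; exact hMA t ht)
  have hD_norm : ∀ t, 0 ≤ t → ‖C t * leadingColumns hk.1 (Q t)‖ ≤ MC := fun t ht =>
    (norm_mul_le_of_transpose_mul_self (hQ.leadingColumns_transpose_mul_self hk.1 ht)).trans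
      (hMC t ht)
  obtain ⟨P, p₁, p₂, hPa, hP, hp₁, hp₂, hPb⟩ := exists_isRiccatiSolution_loewnerBounds ha
    (continuousOn_transformedMatrix hA hQk) (continuousOn_matrix_mul hC hQk) hB_norm hD_norm hobs
    hGc hg₁ hg₂ hG hP₀
  exact ⟨P, hPa, hP, ⟨p₁, p₂, hp₁, hp₂, hPb⟩, hQ.isUniformlyExponentiallyStable_observer hA hMA
    hMC hk ha hP hp₁ hp₂ hg₁ hPb fun t ht => (hG t ht).1⟩

theorem IsQRFrame.norm_observerGain_le (hQ : IsQRFrame A Q) (hk : k ≤ n)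
    (hMC : ∀ t, 0 ≤ t → ‖C t‖ ≤ MC) (hp₁ : 0 < p₁) (hp₂ : 0 < p₂) (hPb : LoewnerBounds 0 p₁ p₂ P)
    {t : ℝ} (ht : 0 ≤ t) :
    ‖leadingColumns hk (Q t) * P t * (leadingColumns hk (Q t))ᵀ * (C t)ᵀ‖ ≤ p₂ * MC := by
  have hQk : ‖leadingColumns hk (Q t)‖ ≤ 1 :=
    l2_opNorm_le_one_of_transpose_mul_self (hQ.leadingColumns_transpose_mul_self hk ht)
  have hPt := hPb.norm_le hp₁ hp₂ ht
  calc _ ≤ ‖leadingColumns hk (Q t)‖ * ‖P t‖ * ‖(leadingColumns hk (Q t))ᵀ‖ * ‖(C t)ᵀ‖ :=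
        (l2_opNorm_mul _ _).trans <| by
          gcongr
          exact (l2_opNorm_mul _ _).trans (by gcongr; exact l2_opNorm_mul _ _)
    _ ≤ 1 * p₂ * 1 * MC := by
      rw [l2_opNorm_transpose, l2_opNorm_transpose]
      gcongr
      exact hMC t ht
    _ = p₂ * MC := by ring

theorem IsQRFrame.isUniformlyExponentiallyDetectable (hQ : IsQRFrame A Q)
    (hA : ContinuousOn A (Ici 0)) (hMA : ∀ t, 0 ≤ t → ‖A t‖ ≤ MA) (hC : ContinuousOn C (Ici 0))
    (hMC : ∀ t, 0 ≤ t → ‖C t‖ ≤ MC) (hk : k ∈ stableTailIndices A Q)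
    (hobs : IsUniformlyCompletelyObservable
      (fun t => transformedMatrix (A t) (leadingColumns hk.1 (Q t)))
      (fun t => C t * leadingColumns hk.1 (Q t))) :
    IsUniformlyExponentiallyDetectable A C := by
  obtain ⟨P, _, hP, ⟨p₁, p₂, hp₁, hp₂, hPb⟩, hstable⟩ :=
    hQ.exists_stableObserver hA hMA hC hMC hk le_rfl hobs (G := fun _ => 1) continuousOn_const
      one_pos one_pos (fun t _ => by simp [PosSemidef.zero]) PosDef.one
  have hQk := hQ.continuousOn_leadingColumns hk.1
  exact ⟨fun t => leadingColumns hk.1 (Q t) * P t * (leadingColumns hk.1 (Q t))ᵀ * (C t)ᵀ,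
    continuousOn_matrix_mul (continuousOn_matrix_mul (continuousOn_matrix_mul hQk hP.continuousOn)
      (continuousOn_matrix_transpose hQk)) (continuousOn_matrix_transpose hC),
    ⟨p₂ * MC, fun t ht => hQ.norm_observerGain_le hk.1 hMC hp₁ hp₂ hPb ht⟩, hstable⟩

end ObserverGain

theorem mainTheorem1_general {n p : ℕ} {A Q : ℝ → Matrix (Fin n) (Fin n) ℝ}
    {C : ℝ → Matrix (Fin p) (Fin n) ℝ}
    (hA : ContinuousOn A (Ici 0)) (hA_bdd : ∃ M : ℝ, ∀ t, 0 ≤ t → ‖A t‖ ≤ M)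
    (hC : ContinuousOn C (Ici 0)) (hC_bdd : ∃ M : ℝ, ∀ t, 0 ≤ t → ‖C t‖ ≤ M)
    (hQ : IsQRFrame A Q) {j : ℕ} (hj : j ∈ stableTailIndices A Q)
    {Qbar : ℝ → Matrix (Fin n) (Fin j) ℝ} (hQbar : ∀ t, Qbar t = leadingColumns hj.1 (Q t))
    {B₁ : ℝ → Matrix (Fin j) (Fin j) ℝ} (hB₁ : ∀ t, B₁ t = transformedMatrix (A t) (Qbar t))
    (hobs : IsUniformlyCompletelyObservable B₁ (fun t => C t * Qbar t)) :
    (∀ (a : ℝ) (G₁ : ℝ → Matrix (Fin j) (Fin j) ℝ) (g₁ g₂ : ℝ) (P₀ : Matrix (Fin j) (Fin j) ℝ),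
      0 ≤ a → ContinuousOn G₁ (Ici a) → 0 < g₁ → 0 < g₂ → LoewnerBounds a g₁ g₂ G₁ → P₀.PosDef →
      ∃ P₁ : ℝ → Matrix (Fin j) (Fin j) ℝ,
        P₁ a = P₀ ∧
        IsRiccatiSolution a B₁ (fun t => C t * Qbar t) G₁ P₁ ∧
        (∃ p₁ p₂ : ℝ, 0 < p₁ ∧ 0 < p₂ ∧ LoewnerBounds a p₁ p₂ P₁) ∧
        IsUniformlyExponentiallyStable a
          (fun t => A t - Qbar t * P₁ t * (Qbar t)ᵀ * (C t)ᵀ * C t)) ∧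
    IsUniformlyExponentiallyDetectable A C := by
  obtain ⟨MA, hMA⟩ := hA_bdd
  obtain ⟨MC, hMC⟩ := hC_bdd
  obtain rfl : Qbar = fun t => leadingColumns hj.1 (Q t) := funext hQbar
  obtain rfl : B₁ = fun t => transformedMatrix (A t) (leadingColumns hj.1 (Q t)) := funext hB₁
  exact ⟨fun _ _ _ _ _ ha hGc hg₁ hg₂ hG hP₀ =>
      hQ.exists_stableObserver hA hMA hC hMC hj ha hobs hGc hg₁ hg₂ hG hP₀,
    hQ.isUniformlyExponentiallyDetectable hA hMA hC hMC hj hobs⟩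

theorem mainTheorem1 {n p : ℕ}
    (A : ℝ → Matrix (Fin n) (Fin n) ℝ) (C : ℝ → Matrix (Fin p) (Fin n) ℝ)
    (hA : ContinuousOn A (Set.Ici 0)) (hA_bdd : ∃ M : ℝ, ∀ t, 0 ≤ t → ‖A t‖ ≤ M)
    (hC : ContinuousOn C (Set.Ici 0)) (hC_bdd : ∃ M : ℝ, ∀ t, 0 ≤ t → ‖C t‖ ≤ M)
    (t₀ : ℝ) (ht₀ : 0 ≤ t₀)
    (X Q R : ℝ → Matrix (Fin n) (Fin n) ℝ) (hQR : IsContinuousQR A t₀ X Q R)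
    (j : ℕ) (hj : IsLeast (stableTailIndices A Q) j)
    (Qbar : ℝ → Matrix (Fin n) (Fin j) ℝ) (hQbar : ∀ t, Qbar t = leadingColumns hj.1.1 (Q t))
    (B₁ : ℝ → Matrix (Fin j) (Fin j) ℝ) (hB₁ : ∀ t, B₁ t = transformedMatrix (A t) (Qbar t))
    (hobs : IsUniformlyCompletelyObservable B₁ (fun t => C t * Qbar t)) :
    (∀ (G₁ : ℝ → Matrix (Fin j) (Fin j) ℝ) (g₁ g₂ : ℝ) (P₀ : Matrix (Fin j) (Fin j) ℝ),
      ContinuousOn G₁ (Set.Ici t₀) → 0 < g₁ → 0 < g₂ → LoewnerBounds t₀ g₁ g₂ G₁ → P₀.PosDef →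
      ∃ P₁ : ℝ → Matrix (Fin j) (Fin j) ℝ,
        P₁ t₀ = P₀ ∧
        IsRiccatiSolution t₀ B₁ (fun t => C t * Qbar t) G₁ P₁ ∧
        (∃ p₁ p₂ : ℝ, 0 < p₁ ∧ 0 < p₂ ∧ LoewnerBounds t₀ p₁ p₂ P₁) ∧
        IsUniformlyExponentiallyStable t₀
          (fun t => A t - Qbar t * P₁ t * (Qbar t)ᵀ * (C t)ᵀ * C t)) ∧
    IsUniformlyExponentiallyDetectable A C := by
  have h := mainTheorem1_general hA hA_bdd hC hC_bdd
    (isQRFrame_of_ode ht₀ hQR.ode_Q hQR.orthogonal_init) hj.1 hQbar hB₁ hobs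
  exact ⟨fun G₁ g₁ g₂ P₀ => h.1 t₀ G₁ g₁ g₂ P₀ ht₀, h.2⟩
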